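/- **Setting.** Let $\Bbbk$ be a commutative ring, $G$ a group and $\mathcal C$ a $G$-graded pivotal $\Bbbk$-linear monoidal category: every object $X$ has a dual $X^*$ with $\mathrm{ev}_X:X^*\otimes X\to\mathbb 1$, $\mathrm{coev}_X:\mathbb 1\to X\otimes X^*$, $\widetilde{\mathrm{ev}}_X:X\otimes X^*\to\mathbb 1$, $\widetilde{\mathrm{coev}}_X:\mathbb 1\to X^*\otimes X$ whose left and right dual functors coincide as monoidal functors; $\mathcal C$ has finite direct sums; and there are full subcategories $\mathcal C_\alpha$ ($\alpha\in G$), closed under finite direct sums, such that each object of $\mathcal C$ is a finite direct sum of objects of the $\mathcal C_\alpha$'s, $\mathcal C_\alpha\otimes\mathcal C_\beta\subset\mathcal C_{\alpha\beta}$, $\mathcal C_\alpha^*\subset\mathcal C_{\alpha^{-1}}$, $\mathbb 1\in\mathcal C_1$, and $\mathrm{Hom}(X,Y)=0$ for $X\in\mathcal C_\alpha$, $Y\in\mathcal C_\beta$, $\alpha\neq\beta$. Assume that $\mathcal C$ is *non-singular*: $d\otimes\mathrm{id}_X=\mathrm{id}_X\otimes d$ for all $d\in\mathrm{End}(\mathbb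 1)$ and all $X$, idempotents split, and for each $\alpha$ the class $\mathcal E_\alpha$ of objects $V\in\mathcal C_\alpha$ with invertible left dimension $d_V=\mathrm{ev}_V\,\widetilde{\mathrm{coev}}_V$ is non-empty. Assume also that $\mathcal C$ is *$G$-centralizable*: for all $\alpha\in G$ and $X\in\mathcal C$ the coend $Z_\alpha(X)=\int^{Y\in\mathcal C_\alpha}Y^*\otimes X\otimes Y$ exists in $\mathcal C$. Fix such coends, with universal dinatural transformations $\rho^\alpha_{X,Y}:Y^*\otimes X\otimes Y\to Z_\alpha(X)$, and put $$\partial^\alpha_{X,Y}=(\mathrm{id}_Y\otimes\rho^\alpha_{X,Y})(\mathrm{coev}_Y\otimes\mathrm{id}_{X\otimes Y}):X\otimes Y\to Y\otimes Z_\alpha(X)\qquad(Y\in\mathcal C_\alpha).$$ (Associativity and unit constraints are suppressed.) **Center and crossing.** The objects of $\mathcal Z_G(\mathcal C)$ are the pairs $(A,\sigma)$ with $A\in\mathcal C$ and $\sigma=\{\sigma_X:A\otimes X\to X\otimes A\}_{X\in\mathcal C_1}$ a natural family of isomorphisms with $\sigma_{X\otimes Y}=(\mathrm{id}_X\otimes\sigma_Y)(\sigma_X\otimes\mathrm{id}_Y)$;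 its morphisms are the morphisms of $\mathcal C$ commuting with the $\sigma$'s. For $V\in\mathcal E_\alpha$, the endomorphism $$\pi^V_{(A,\sigma)}=d_V^{-1}(\mathrm{ev}_V\otimes\mathrm{id}_{V^*\otimes A\otimes V})(\mathrm{id}_{V^*}\otimes\sigma_{V\otimes V^*}\otimes\mathrm{id}_V)(\mathrm{id}_{V^*\otimes A\otimes V}\otimes\widetilde{\mathrm{coev}}_V)$$ of $V^*\otimes A\otimes V$ is an idempotent; fix a splitting $p^V:V^*\otimes A\otimes V\to E^V$, $q^V:E^V\to V^*\otimes A\otimes V$, $q^Vp^V=\pi^V$, $p^Vq^V=\mathrm{id}$. Let $\varphi_V$ be the endofunctor of $\mathcal Z_G(\mathcal C)$ with $\varphi_V(A,\sigma)=(E^V,\gamma^V)$, where $$\gamma^V_X=d_V^{-1}(\mathrm{id}_X\otimes p^V)(\mathrm{ev}_V\otimes\mathrm{id}_{X\otimes V^*\otimes A\otimes V})(\mathrm{id}_{V^*}\otimes\sigma_{V\otimes X\otimes V^*}\otimes\mathrm{id}_V)(\mathrm{id}_{V^*\otimes A\otimes V\otimes X}\otimes\widetilde{\mathrm{coev}}_V)(q^V\otimes\mathrm{id}_X),$$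 and $\varphi_V(f)=p^V(\mathrm{id}_{V^*}\otimes f\otimes\mathrm{id}_V)q^V$. With the natural isomorphisms $$\delta^{U,V}=d_V^{-1}p^U(\mathrm{ev}_V\otimes\mathrm{id}_{U^*\otimes A\otimes U})(\mathrm{id}_{V^*}\otimes\sigma_{V\otimes U^*}\otimes\mathrm{id}_U)(\mathrm{id}_{V^*\otimes A\otimes V}\otimes\widetilde{\mathrm{coev}}_U)q^V:\varphi_V\to\varphi_U\qquad(U,V\in\mathcal E_\alpha),$$ the $\varphi_V$ form a projective system; let $\varphi_\alpha$ be a projective limit of it, with universal cone $\iota^\alpha_V:\varphi_\alpha\to\varphi_V$. The *enhanced $G$-braiding* is the family of morphisms $\tau_{(A,\sigma),Y}:A\otimes Y\to Y\otimes\varphi_\alpha(A,\sigma)$, for $(A,\sigma)\in\mathcal Z_G(\mathcal C)$ and $Y\in\mathcal C_\alpha$, determined by $$(\mathrm{id}_Y\otimes(\iota^\alpha_V)_{(A,\sigma)})\,\tau_{(A,\sigma),Y}=(\mathrm{id}_Y\otimes p^V)(\sigma_{Y\otimes V^*}\otimes\mathrm{id}_V)(\mathrm{id}_{A\otimes Y}\otimes\widetilde{\mathrm{coev}}_V)\qquad\text{for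 all }V\in\mathcal E_\alpha.$$ **Free objects.** Let $Z_2(\alpha,\beta)_X:Z_\alpha Z_\beta(X)\to Z_{\beta\alpha}(X)$ be the unique morphism such that $$\bigl(\mathrm{id}_{Y'}\otimes(\mathrm{id}_Y\otimes Z_2(\alpha,\beta)_X)\,\partial^\alpha_{Z_\beta(X),Y}\bigr)(\partial^\beta_{X,Y'}\otimes\mathrm{id}_Y)=\partial^{\beta\alpha}_{X,Y'\otimes Y}\qquad\text{for all }Y\in\mathcal C_\alpha,\ Y'\in\mathcal C_\beta.$$ The free object is $\mathcal F_\alpha(X)=(Z_\alpha(X),\sigma^\alpha_X)\in\mathcal Z_G(\mathcal C)$ with $\sigma^\alpha_{X,Y}=(\mathrm{id}_Y\otimes Z_2(1,\alpha)_X)\,\partial^1_{Z_\alpha(X),Y}$ for $Y\in\mathcal C_1$. Let $\omega^{\beta,\alpha}_X:\varphi_\beta\mathcal F_\alpha(X)\to\mathcal F_{\alpha\beta}(X)$ be the morphism of $\mathcal Z_G(\mathcal C)$ such that, for every $V\in\mathcal E_\beta$, $$\omega^{\beta,\alpha}_X=d_V^{-1}\,(\mathrm{ev}_V\otimes\mathrm{id}_{Z_{\alpha\beta}(X)})\bigl(\mathrm{id}_{V^*}\otimes(\mathrm{id}_V\otimes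 Z_2(\beta,\alpha)_X)\,\partial^\beta_{Z_\alpha(X),V}\bigr)\,q^V\,(\iota^\beta_V)_{\mathcal F_\alpha(X)}.$$ **Theorem 9.4.** Let $\alpha,\beta\in G$, $X\in\mathcal C$ and $Y\in\mathcal C_\beta$. Then $\omega^{\beta,\alpha}_X$ is an isomorphism and $$\tau_{\mathcal F_\alpha(X),Y}=\bigl(\mathrm{id}_Y\otimes(\omega^{\beta,\alpha}_X)^{-1}Z_2(\beta,\alpha)_X\bigr)\,\partial^\beta_{Z_\alpha(X),Y}.$$ **Fusion case.** Call an object $i$ simple if $\mathrm{End}(i)$ is a free $\Bbbk$-module of rank $1$. Suppose in addition that $\mathcal C$ is $G$-fusion: $\mathbb 1$ is simple, every object is a finite direct sum of simple objects, $\mathrm{Hom}(i,j)=0$ for non-isomorphic simple $i,j$, and each $\mathcal C_\delta$ contains at least one and, up to isomorphism, only finitely many simple objects. Let $I$ be a set of homogeneous simple objects such that every simple object is isomorphic to exactly one element of $I$, and let $I_\delta$ be the set of elements of $I$ lying in $\mathcal C_\delta$. Then: 1. for every $\delta\in G$, the morphisms $\rho^\delta_{X,i}:i^*\otimes X\otimes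 i\to Z_\delta(X)$, $i\in I_\delta$, are the inclusions of a direct sum decomposition $Z_\delta(X)=\bigoplus_{i\in I_\delta}i^*\otimes X\otimes i$; 2. for every $i\in I_\alpha$, the object $i\otimes Y$ is a finite direct sum of objects $j_{i,l}\in I_{\alpha\beta}$, with projections $p_{i,l}:i\otimes Y\to j_{i,l}$ and inclusions $q_{i,l}:j_{i,l}\to i\otimes Y$; 3. if $\pi_i:Z_\alpha(X)\to i^*\otimes X\otimes i$ $(i\in I_\alpha)$ are the projections of the decomposition in 1 for $\delta=\alpha$, and $(j_{i,l},p_{i,l},q_{i,l})_l$ are any decompositions as in 2, then $$(\mathrm{id}_Y\otimes\omega^{\beta,\alpha}_X)\,\tau_{\mathcal F_\alpha(X),Y}=\sum_{i\in I_\alpha}\sum_l\bigl(\mathrm{id}_Y\otimes\rho^{\alpha\beta}_{X,j_{i,l}}\bigr)\,\Theta_{i,l}\,(\pi_i\otimes\mathrm{id}_Y),$$ where $$\Theta_{i,l}=\bigl((\mathrm{ev}_i\otimes\mathrm{id}_{Y\otimes j_{i,l}^*})(\mathrm{id}_{i^*}\otimes q_{i,l}\otimes\mathrm{id}_{j_{i,l}^*})(\mathrm{id}_{i^*}\otimes\mathrm{coev}_{j_{i,l}})\bigr)\otimes\mathrm{id}_X\otimes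 p_{i,l}:\ i^*\otimes X\otimes i\otimes Y\to Y\otimes j_{i,l}^*\otimes X\otimes j_{i,l}.$$ -/

import Mathlib

open CategoryTheory MonoidalCategory Limits Opposite

universe w v u

namespace GCat

noncomputable section

section Pivotal

variable {C : Type u} [Category.{v} C] [MonoidalCategory C]

/-- The dual `f^* : Y^* ⟶ X^*` of `f : X ⟶ Y`, computed from pairings
`ev : Y^* ⊗ Y ⟶ 𝟙`, `coev : 𝟙 ⟶ X ⊗ X^*` (left duals). -/
def leftMate {X X' Y Y' : C} [ExactPairing X X'] [ExactPairing Y Y'] (f : X ⟶ Y) : Y' ⟶ X' :=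
  (ρ_ _).inv ≫ Y' ◁ η_ X X' ≫ Y' ◁ f ▷ X' ≫ (α_ _ _ _).inv ≫ ε_ Y Y' ▷ X' ≫ (λ_ _).hom

/-- The dual `f^* : Y^* ⟶ X^*` of `f : X ⟶ Y`, computed from pairings
`Y ⊗ Y^* ⟶ 𝟙`, `𝟙 ⟶ X^* ⊗ X` (right duals). -/
def rightMate {X X' Y Y' : C} [ExactPairing X' X] [ExactPairing Y' Y] (f : X ⟶ Y) : Y' ⟶ X' :=
  (λ_ _).inv ≫ η_ X' X ▷ Y' ≫ (X' ◁ f) ▷ Y' ≫ (α_ _ _ _).hom ≫ X' ◁ ε_ Y' Y ≫ (ρ_ _).hom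

variable (C) in
/-- A pivotal category: every object `X` has a dual object `X^*` which is at the same time a left
dual, through `ev`, `coev`, and a right dual, through `evt`, `coevt`, and the resulting left and
right dual functors `Cᵒᵖ ⥤ C` agree as monoidal functors, i.e. on morphisms and in their monoidal
constraints `X^* ⊗ Y^* ⟶ (Y ⊗ X)^*` and `𝟙 ⟶ 𝟙^*`.
In Mathlib, `ExactPairing X Y` consists of `η_ X Y : 𝟙 ⟶ X ⊗ Y` and `ε_ X Y : Y ⊗ X ⟶ 𝟙`
satisfying the two zigzag identities. -/
class PivotalCategory where
  dual : C → C
  leftPairing (X : C) : ExactPairing X (dual X)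
  rightPairing (X : C) : ExactPairing (dual X) X
  mate_eq {X Y : C} (f : X ⟶ Y) :
    (leftMate f : dual Y ⟶ dual X) = rightMate f
  tensor_eq (X Y : C) :
    (𝟙 _ ⊗≫ (dual X ⊗ dual Y) ◁ η_ (Y ⊗ X) (dual (Y ⊗ X)) ⊗≫
        dual X ◁ (ε_ Y (dual Y) ▷ (X ⊗ dual (Y ⊗ X))) ⊗≫
        ε_ X (dual X) ▷ dual (Y ⊗ X) ⊗≫ 𝟙 _ : dual X ⊗ dual Y ⟶ dual (Y ⊗ X)) =
      𝟙 _ ⊗≫ η_ (dual (Y ⊗ X)) (Y ⊗ X) ▷ (dual X ⊗ dual Y) ⊗≫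
        (dual (Y ⊗ X) ⊗ Y) ◁ (ε_ (dual X) X ▷ dual Y) ⊗≫
        dual (Y ⊗ X) ◁ ε_ (dual Y) Y ⊗≫ 𝟙 _
  unit_eq : η_ (𝟙_ C) (dual (𝟙_ C)) ≫ (λ_ _).hom = η_ (dual (𝟙_ C)) (𝟙_ C) ≫ (ρ_ _).hom

attribute [reducible, instance] PivotalCategory.leftPairing PivotalCategory.rightPairing

variable [PivotalCategory C]

/-- The dual object `X^*`. -/
abbrev dual (X : C) : C := PivotalCategory.dual X

/-- `ev_X : X^* ⊗ X ⟶ 𝟙`. -/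
abbrev ev (X : C) : dual X ⊗ X ⟶ 𝟙_ C := ε_ X (dual X)

/-- `coev_X : 𝟙 ⟶ X ⊗ X^*`. -/
abbrev coev (X : C) : 𝟙_ C ⟶ X ⊗ dual X := η_ X (dual X)

/-- The second evaluation `X ⊗ X^* ⟶ 𝟙`. -/
abbrev evt (X : C) : X ⊗ dual X ⟶ 𝟙_ C := ε_ (dual X) X

/-- The second coevaluation `𝟙 ⟶ X^* ⊗ X`. -/
abbrev coevt (X : C) : 𝟙_ C ⟶ dual X ⊗ X := η_ (dual X) X

/-- The dual morphism `f^* : Y^* ⟶ X^*`. -/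
abbrev dualMap {X Y : C} (f : X ⟶ Y) : dual Y ⟶ dual X := leftMate f

/-- The left dimension `dim_l(X) ∈ End(𝟙)`. -/
def dimL (X : C) : 𝟙_ C ⟶ 𝟙_ C := coevt X ≫ ev X

end Pivotal

section Scalars

variable {C : Type u} [Category.{v} C] [MonoidalCategory C]

/-- The product `d f` of `d ∈ End(𝟙)` with a morphism `f`. -/
def scal (d : 𝟙_ C ⟶ 𝟙_ C) {A B : C} (f : A ⟶ B) : A ⟶ B :=
  (λ_ A).inv ≫ d ▷ A ≫ (λ_ A).hom ≫ f

variable (C) in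
/-- A monoidal category is pure if `d ⊗ id_X = id_X ⊗ d` for all `d ∈ End(𝟙)`. -/
def IsPure : Prop :=
  ∀ (d : 𝟙_ C ⟶ 𝟙_ C) (X : C),
    (λ_ X).inv ≫ d ▷ X ≫ (λ_ X).hom = (ρ_ X).inv ≫ X ◁ d ≫ (ρ_ X).hom

theorem scal_comp (d : 𝟙_ C ⟶ 𝟙_ C) {X Y Z : C} (f : X ⟶ Y) (g : Y ⟶ Z) :
    scal d f ≫ g = scal d (f ≫ g) := by
  simp [scal]

theorem comp_scal (d : 𝟙_ C ⟶ 𝟙_ C) {X Y Z : C} (f : X ⟶ Y) (g : Y ⟶ Z) :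
    f ≫ scal d g = scal d (f ≫ g) := by
  simp only [scal]
  rw [leftUnitor_inv_naturality_assoc, whisker_exchange_assoc, leftUnitor_naturality_assoc]

theorem scal_scal (d e : 𝟙_ C ⟶ 𝟙_ C) {X Y : C} (f : X ⟶ Y) :
    scal d (scal e f) = scal (d ≫ e) f := by
  simp [scal]

theorem scal_comm (d e : 𝟙_ C ⟶ 𝟙_ C) {X Y : C} (f : X ⟶ Y) :
    scal d (scal e f) = scal e (scal d f) := by
  calc scal d (scal e f) = scal d (scal e (𝟙 X) ≫ f) := by rw [scal_comp, Category.id_comp]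
    _ = _ := by rw [← comp_scal, scal_comp, Category.id_comp]

theorem scal_one {X Y : C} (f : X ⟶ Y) : scal (𝟙 (𝟙_ C)) f = f := by
  simp [scal]

theorem scal_whiskerRight (d : 𝟙_ C ⟶ 𝟙_ C) {X Y : C} (f : X ⟶ Y) (Z : C) :
    scal d f ▷ Z = scal d (f ▷ Z) := by
  simp only [scal]; monoidal

theorem IsPure.whiskerLeft_scal (h : IsPure C) (d : 𝟙_ C ⟶ 𝟙_ C) {X Y : C} (f : X ⟶ Y) (Z : C) :
    Z ◁ scal d f = scal d (Z ◁ f) := by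
  have h2 : (λ_ (Z ⊗ X)).inv ≫ d ▷ (Z ⊗ X) ≫ (λ_ (Z ⊗ X)).hom =
      ((λ_ Z).inv ≫ d ▷ Z ≫ (λ_ Z).hom) ▷ X := by monoidal
  calc Z ◁ scal d f = ((ρ_ Z).inv ≫ Z ◁ d ≫ (ρ_ Z).hom) ▷ X ≫ Z ◁ f := by
        simp only [scal]; monoidal
    _ = _ := by rw [← h d Z, ← h2]; simp [scal]

theorem scal_monoidalComp (d : 𝟙_ C ⟶ 𝟙_ C) {X Y Z W : C} [MonoidalCoherence Y Z] (f : X ⟶ Y)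
    (g : Z ⟶ W) : scal d f ⊗≫ g = scal d (f ⊗≫ g) := by
  simp only [monoidalComp, scal_comp]

theorem monoidalComp_scal (d : 𝟙_ C ⟶ 𝟙_ C) {X Y Z W : C} [MonoidalCoherence Y Z] (f : X ⟶ Y)
    (g : Z ⟶ W) : f ⊗≫ scal d g = scal d (f ⊗≫ g) := by
  simp only [monoidalComp, comp_scal]

theorem whiskerRight_eq_scal (d : 𝟙_ C ⟶ 𝟙_ C) (X : C) :
    d ▷ X = scal d (𝟙 (𝟙_ C ⊗ X)) := by
  rw [← id_whiskerRight, ← scal_whiskerRight]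
  congr 1
  simp [scal, unitors_equal, unitors_inv_equal]

theorem existsUnique_lift {I : Type*} {B E : C} (X : C) (F : I → C) (leg : ∀ V, E ⟶ F V)
    (hleg : ∀ V, IsIso (leg V)) (d : ∀ V U, F V ⟶ F U) (hd : ∀ V U, leg V ≫ d V U = leg U)
    (g : ∀ V, B ⟶ X ⊗ F V) (hg : ∀ V U, g V ≫ X ◁ d V U = g U) (hI : Nonempty I) :
    ∃! t : B ⟶ X ⊗ E, ∀ V, t ≫ X ◁ leg V = g V := by
  obtain ⟨V⟩ := hI
  refine ⟨g V ≫ X ◁ inv (leg V), fun U => ?_, fun t ht => ?_⟩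
  · rw [← hd V U, Category.assoc, ← MonoidalCategory.whiskerLeft_comp, IsIso.inv_hom_id_assoc,
      hg]
  · rw [← ht V, Category.assoc, ← MonoidalCategory.whiskerLeft_comp, IsIso.hom_inv_id,
      MonoidalCategory.whiskerLeft_id, Category.comp_id]

end Scalars

end

end GCat

namespace GCat

noncomputable section

section Grading

variable (G : Type w) [Group G] (C : Type u) [Category.{v} C] [MonoidalCategory C]
  [PivotalCategory C] [Preadditive C] [HasFiniteBiproducts C]

/-- A `G`-grading of `C`: full subcategories `C_α` (for `α ∈ G`), each stable under finite direct
sums (up to isomorphism), such that every object is a finite direct sum of homogeneous ones,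
`C_α ⊗ C_β ⊆ C_{αβ}`, `𝟙 ∈ C_1`, and there are no non-zero morphisms between objects of
distinct degrees. In particular an object of two distinct degrees is a zero object. -/
structure GGrading where
  deg : G → ObjectProperty C
  sum_mem (α : G) (n : ℕ) (f : Fin n → C) (hf : ∀ i, deg α (f i)) :
    ∃ Z : C, deg α Z ∧ Nonempty (Z ≅ ⨁ f)
  exists_decomposition (X : C) : ∃ (n : ℕ) (a : Fin n → G) (f : Fin n → C),
    (∀ i, deg (a i) (f i)) ∧ Nonempty (X ≅ ⨁ f)
  tensor_mem {α β : G} {X Y : C} : deg α X → deg β Y → deg (α * β) (X ⊗ Y)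
  hom_eq_zero {α β : G} {X Y : C} :
    deg α X → deg β Y → α ≠ β → ∀ f : X ⟶ Y, f = 0
  unit_mem : deg 1 (𝟙_ C)

/-- A `G`-grading of a pivotal category, in which the chosen dual of an object of `C_α` lies in
`C_{α⁻¹}`. -/
structure PivotalGrading extends GGrading G C where
  dual_mem {α : G} {X : C} : deg α X → deg α⁻¹ (dual X)

end Grading

section Center

variable {C : Type u} [Category.{v} C] [MonoidalCategory C]

/-- An object `(A, σ)` of the center of `C` relative to the full subcategory of `C` given by `P`:
an object `A` of `C` together with a half-braiding `σ_X : A ⊗ X ≅ X ⊗ A`, where `X` satisfies `P`,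
which is natural and multiplicative. -/
structure RelCenter (P : ObjectProperty C) where
  obj : C
  braid (X : C) (hX : P X) : obj ⊗ X ≅ X ⊗ obj
  natural {X Y : C} (hX : P X) (hY : P Y) (f : X ⟶ Y) :
    obj ◁ f ≫ (braid Y hY).hom = (braid X hX).hom ≫ f ▷ obj
  tensor {X Y : C} (hX : P X) (hY : P Y) (hXY : P (X ⊗ Y)) :
    (braid (X ⊗ Y) hXY).hom = (α_ obj X Y).inv ≫ (braid X hX).hom ▷ Y ≫ (α_ X obj Y).hom ≫
      X ◁ (braid Y hY).hom ≫ (α_ X Y obj).inv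

namespace RelCenter

variable {P : ObjectProperty C}

/-- Morphisms in the relative center: morphisms of `C` commuting with the half-braidings. -/
@[ext]
structure Hom (A B : RelCenter P) where
  hom : A.obj ⟶ B.obj
  comm (X : C) (hX : P X) : hom ▷ X ≫ (B.braid X hX).hom = (A.braid X hX).hom ≫ X ◁ hom

instance : Category (RelCenter P) where
  Hom := Hom
  id A := ⟨𝟙 _, by simp⟩
  comp f g := ⟨f.hom ≫ g.hom, fun X hX => by
    simp [g.comm, reassoc_of% (f.comm X hX)]⟩

@[ext]
theorem hom_ext {A B : RelCenter P} {f g : A ⟶ B} (h : f.hom = g.hom) : f = g :=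
  Hom.ext h

@[simp] theorem id_hom (A : RelCenter P) : Hom.hom (𝟙 A) = 𝟙 A.obj := rfl

@[simp] theorem comp_hom {A B D : RelCenter P} (f : A ⟶ B) (g : B ⟶ D) :
    (f ≫ g).hom = f.hom ≫ g.hom := rfl

variable (P) in
/-- The forgetful functor. -/
def forget : RelCenter P ⥤ C where
  obj A := A.obj
  map f := f.hom

instance {A B : RelCenter P} (f : A ⟶ B) [IsIso f] : IsIso f.hom :=
  inferInstanceAs (IsIso ((forget P).map f))

theorem isIso_of_hom {A B : RelCenter P} (f : A ⟶ B) (h : IsIso f.hom) : IsIso f := by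
  refine ⟨⟨⟨inv f.hom, fun X hX => ?_⟩, ?_, ?_⟩⟩
  · rw [← cancel_epi (f.hom ▷ X), reassoc_of% (f.comm X hX)]
    simp [← comp_whiskerRight_assoc, ← MonoidalCategory.whiskerLeft_comp]
  · ext; exact IsIso.hom_inv_id f.hom
  · ext; exact IsIso.inv_hom_id f.hom

/-- The half-braiding with the unit object is the canonical one. -/
theorem braid_unit (A : RelCenter P) (h : P (𝟙_ C)) (h2 : P (𝟙_ C ⊗ 𝟙_ C)) :
    (A.braid (𝟙_ C) h).hom = (ρ_ A.obj).hom ≫ (λ_ A.obj).inv := by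
  have key : (A.braid (𝟙_ C) h).hom ▷ 𝟙_ C ≫ (α_ _ _ _).hom ≫ 𝟙_ C ◁ (A.braid (𝟙_ C) h).hom =
      (A.braid (𝟙_ C) h).hom ▷ 𝟙_ C ≫ (α_ _ _ _).hom ≫
        𝟙_ C ◁ ((ρ_ A.obj).hom ≫ (λ_ A.obj).inv) := by
    have h1 := A.tensor h h h2
    have h3 := A.natural h2 h (λ_ (𝟙_ C)).hom
    rw [h1] at h3
    have h4 : (A.braid (𝟙_ C) h).hom ▷ 𝟙_ C ≫ (α_ _ _ _).hom ≫ 𝟙_ C ◁ (A.braid (𝟙_ C) h).hom =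
      (α_ _ _ _).hom ≫ (A.obj ◁ (λ_ (𝟙_ C)).hom ≫ (A.braid (𝟙_ C) h).hom) ≫ (λ_ _).inv ▷ _ ≫
        (α_ _ _ _).hom := by
      rw [h3]; monoidal
    rw [h4]
    monoidal
  have h5 := (cancel_epi _).1 ((cancel_epi _).1 key)
  exact (whiskerLeft_iff _ _).1 h5

section Mk

variable [PivotalCategory C]

/-- A natural multiplicative family of morphisms `A ⊗ X ⟶ X ⊗ A` which is trivial for `X = 𝟙` is
a half-braiding: it is invertible if `P` is stable under duality. -/
def mk' (A : C) (s : ∀ X : C, P X → (A ⊗ X ⟶ X ⊗ A))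
    (h1 : P (𝟙_ C)) (hdual : ∀ X, P X → P (dual X)) (ht : ∀ X Y, P X → P Y → P (X ⊗ Y))
    (natural : ∀ {X Y : C} (hX : P X) (hY : P Y) (f : X ⟶ Y), A ◁ f ≫ s Y hY = s X hX ≫ f ▷ A)
    (tensor : ∀ {X Y : C} (hX : P X) (hY : P Y) (hXY : P (X ⊗ Y)),
      s (X ⊗ Y) hXY = (α_ A X Y).inv ≫ s X hX ▷ Y ≫ (α_ X A Y).hom ≫
        X ◁ s Y hY ≫ (α_ X Y A).inv)
    (unit : s (𝟙_ C) h1 = (ρ_ A).hom ≫ (λ_ A).inv) : RelCenter P where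
  obj := A
  braid X hX :=
    { hom := s X hX
      inv := 𝟙 _ ⊗≫ (X ⊗ A) ◁ coevt X ⊗≫ X ◁ s (dual X) (hdual X hX) ▷ X ⊗≫
        evt X ▷ (A ⊗ X) ⊗≫ 𝟙 _
      hom_inv_id := by
        have t := tensor hX (hdual X hX) (ht _ _ hX (hdual X hX))
        have n := natural (ht _ _ hX (hdual X hX)) h1 (evt X)
        rw [unit, t] at n
        calc _ = 𝟙 _ ⊗≫ (s X hX ▷ (𝟙_ C) ≫ (X ⊗ A) ◁ coevt X) ⊗≫
              X ◁ s (dual X) (hdual X hX) ▷ X ⊗≫ evt X ▷ (A ⊗ X) ⊗≫ 𝟙 _ := by monoidal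
          _ = 𝟙 _ ⊗≫ (A ⊗ X) ◁ coevt X ⊗≫ (((α_ A X (dual X)).inv ≫ s X hX ▷ (dual X) ≫
                (α_ X A (dual X)).hom ≫ X ◁ s (dual X) (hdual X hX) ≫
                  (α_ X (dual X) A).inv) ≫ evt X ▷ A) ▷ X ⊗≫ 𝟙 _ := by
              rw [← whisker_exchange]; monoidal
          _ = 𝟙 _ ⊗≫ A ◁ (X ◁ coevt X ⊗≫ evt X ▷ X) ⊗≫ 𝟙 _ := by
              rw [← n]; monoidal
          _ = _ := by
              rw [ExactPairing.coevaluation_evaluation'']; monoidal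
      inv_hom_id := by
        have t := tensor (hdual X hX) hX (ht _ _ (hdual X hX) hX)
        have n := natural h1 (ht _ _ (hdual X hX) hX) (coevt X)
        rw [unit, t] at n
        calc _ = 𝟙 _ ⊗≫ (X ⊗ A) ◁ coevt X ⊗≫ X ◁ s (dual X) (hdual X hX) ▷ X ⊗≫
              (evt X ▷ (A ⊗ X) ≫ 𝟙_ C ◁ s X hX) ⊗≫ 𝟙 _ := by monoidal
          _ = 𝟙 _ ⊗≫ X ◁ (A ◁ coevt X ≫ ((α_ A (dual X) X).inv ≫ s (dual X) (hdual X hX) ▷ X ≫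
                (α_ (dual X) A X).hom ≫ (dual X) ◁ s X hX ≫
                  (α_ (dual X) X A).inv)) ⊗≫ evt X ▷ (X ⊗ A) ⊗≫ 𝟙 _ := by
              rw [← whisker_exchange]; monoidal
          _ = 𝟙 _ ⊗≫ (X ◁ coevt X ⊗≫ evt X ▷ X) ▷ A ⊗≫ 𝟙 _ := by
              rw [n]; monoidal
          _ = _ := by
              rw [ExactPairing.coevaluation_evaluation'']; monoidal }
  natural := natural
  tensor := tensor

end Mk

end RelCenter

end Center

end

end GCat

namespace GCat

noncomputable section

section Splitting

variable {C : Type u} [Category.{v} C]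

/-- A splitting of an endomorphism `e`. -/
structure Splitting {X : C} (e : X ⟶ X) where
  obj : C
  p : X ⟶ obj
  q : obj ⟶ X
  p_q : p ≫ q = e
  q_p : q ≫ p = 𝟙 obj

theorem Splitting.q_e_p {X : C} {e : X ⟶ X} (s : Splitting e) : s.q ≫ e ≫ s.p = 𝟙 _ :=
  calc s.q ≫ e ≫ s.p = s.q ≫ (s.p ≫ s.q) ≫ s.p := by rw [s.p_q]
    _ = 𝟙 _ := by simp [s.q_p]

end Splitting

section Crossing

variable {G : Type w} [Group G] {C : Type u} [Category.{v} C] [MonoidalCategory C]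
  [PivotalCategory C] [Preadditive C] [HasFiniteBiproducts C]

/-- The `G`-center of `C`, i.e. the center of `C` relative to `C_1`. -/
abbrev GCenter (D : PivotalGrading G C) := RelCenter (D.deg 1)

/-- The class `E_α` of objects of `C_α` with invertible left dimension. -/
structure InvObj (D : PivotalGrading G C) (α : G) where
  obj : C
  mem : D.deg α obj
  isIso_dim : IsIso (dimL obj)

/-- A non-singular grading: `C` is pure, idempotents split, and every `C_α` contains an object with
invertible left dimension. -/
structure NonSingular (D : PivotalGrading G C) : Prop where
  pure : IsPure C
  split : IsIdempotentComplete C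
  exists_inv (α : G) : Nonempty (InvObj D α)

theorem PivotalGrading.mem_cast (D : PivotalGrading G C) {α β : G} {X : C} (h : D.deg α X)
    (e : α = β) : D.deg β X := e ▸ h

theorem PivotalGrading.mem_tensor_dual (D : PivotalGrading G C) {α : G} {X Y : C}
    (hX : D.deg α X) (hY : D.deg α Y) : D.deg 1 (X ⊗ dual Y) :=
  D.mem_cast (D.tensor_mem hX (D.dual_mem hY)) (mul_inv_cancel α)

theorem PivotalGrading.mem_tensor_one (D : PivotalGrading G C) {α : G} {X Y : C}
    (hX : D.deg α X) (hY : D.deg 1 Y) : D.deg α (X ⊗ Y) :=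
  D.mem_cast (D.tensor_mem hX hY) (mul_one α)

theorem PivotalGrading.mem_one_tensor (D : PivotalGrading G C) {α : G} {X Y : C}
    (hX : D.deg 1 X) (hY : D.deg α Y) : D.deg α (X ⊗ Y) :=
  D.mem_cast (D.tensor_mem hX hY) (one_mul α)

theorem PivotalGrading.dual_mem_one (D : PivotalGrading G C) {X : C}
    (hX : D.deg 1 X) : D.deg 1 (dual X) :=
  D.mem_cast (D.dual_mem hX) inv_one

variable {D : PivotalGrading G C}

/-- The morphism `(σ_{W ⊗ U^*} ⊗ U) (A ⊗ W ⊗ coevt_U)`, where `W ⊗ U^*` has degree `1`. -/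
def push (A : GCenter D) (W U : C) (h : D.deg 1 (W ⊗ dual U)) :
    A.obj ⊗ W ⟶ W ⊗ (dual U ⊗ (A.obj ⊗ U)) :=
  𝟙 _ ⊗≫ (A.obj ⊗ W) ◁ coevt U ⊗≫ (A.braid (W ⊗ dual U) h).hom ▷ U ⊗≫ 𝟙 _

theorem push_natural (A : GCenter D) {W W' : C} (U : C) (h : D.deg 1 (W ⊗ dual U))
    (h' : D.deg 1 (W' ⊗ dual U)) (f : W ⟶ W') :
    A.obj ◁ f ≫ push A W' U h' = push A W U h ≫ f ▷ _ := by
  have n := A.natural h h' (f ▷ dual U)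
  calc _ = 𝟙 _ ⊗≫ ((A.obj ◁ f) ▷ 𝟙_ C ≫ (A.obj ⊗ W') ◁ coevt U) ⊗≫
        (A.braid (W' ⊗ dual U) h').hom ▷ U ⊗≫ 𝟙 _ := by unfold push; monoidal
    _ = 𝟙 _ ⊗≫ (A.obj ⊗ W) ◁ coevt U ⊗≫ (A.obj ◁ (f ▷ dual U) ≫
        (A.braid (W' ⊗ dual U) h').hom) ▷ U ⊗≫ 𝟙 _ := by
      rw [← whisker_exchange]; monoidal
    _ = _ := by rw [n]; unfold push; monoidal

theorem push_natural_left {A B : GCenter D} (f : A ⟶ B) (W U : C) (h : D.deg 1 (W ⊗ dual U)) :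
    f.hom ▷ W ≫ push B W U h = push A W U h ≫ W ◁ (dual U ◁ (f.hom ▷ U)) := by
  have n := f.comm _ h
  calc _ = 𝟙 _ ⊗≫ ((f.hom ▷ W) ▷ 𝟙_ C ≫ (B.obj ⊗ W) ◁ coevt U) ⊗≫
        (B.braid (W ⊗ dual U) h).hom ▷ U ⊗≫ 𝟙 _ := by unfold push; monoidal
    _ = 𝟙 _ ⊗≫ (A.obj ⊗ W) ◁ coevt U ⊗≫ (f.hom ▷ (W ⊗ dual U) ≫
        (B.braid (W ⊗ dual U) h).hom) ▷ U ⊗≫ 𝟙 _ := by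
      rw [← whisker_exchange]; monoidal
    _ = _ := by rw [n]; unfold push; monoidal

/-- The morphism `V^* ⊗ A ⊗ V ⊗ X ⟶ X ⊗ U^* ⊗ A ⊗ U` obtained from `push A (V ⊗ X) U` by
evaluating `V`. -/
def pass (A : GCenter D) (V X U : C) (h : D.deg 1 ((V ⊗ X) ⊗ dual U)) :
    (dual V ⊗ (A.obj ⊗ V)) ⊗ X ⟶ X ⊗ (dual U ⊗ (A.obj ⊗ U)) :=
  𝟙 _ ⊗≫ dual V ◁ push A (V ⊗ X) U h ⊗≫ ev V ▷ (X ⊗ (dual U ⊗ (A.obj ⊗ U))) ⊗≫ 𝟙 _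

/-- The morphism `V^* ⊗ A ⊗ V ⟶ U^* ⊗ A ⊗ U` obtained from `push A V U` by evaluating `V`. -/
def pass₀ (A : GCenter D) (V U : C) (h : D.deg 1 (V ⊗ dual U)) :
    dual V ⊗ (A.obj ⊗ V) ⟶ dual U ⊗ (A.obj ⊗ U) :=
  𝟙 _ ⊗≫ dual V ◁ push A V U h ⊗≫ ev V ▷ (dual U ⊗ (A.obj ⊗ U)) ⊗≫ 𝟙 _

theorem pass_natural_right (A : GCenter D) (V : C) {X X' : C} (U : C)
    (h : D.deg 1 ((V ⊗ X) ⊗ dual U)) (h' : D.deg 1 ((V ⊗ X') ⊗ dual U)) (f : X ⟶ X') :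
    (dual V ⊗ (A.obj ⊗ V)) ◁ f ≫ pass A V X' U h' = pass A V X U h ≫ f ▷ _ := by
  have n := push_natural A U h h' (V ◁ f)
  calc _ = 𝟙 _ ⊗≫ dual V ◁ (A.obj ◁ (V ◁ f) ≫ push A (V ⊗ X') U h') ⊗≫
        ev V ▷ (X' ⊗ (dual U ⊗ (A.obj ⊗ U))) ⊗≫ 𝟙 _ := by unfold pass; monoidal
    _ = 𝟙 _ ⊗≫ dual V ◁ push A (V ⊗ X) U h ⊗≫ ((dual V ⊗ V) ◁ (f ▷ (dual U ⊗ (A.obj ⊗ U))) ≫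
        ev V ▷ (X' ⊗ (dual U ⊗ (A.obj ⊗ U)))) ⊗≫ 𝟙 _ := by rw [n]; monoidal
    _ = _ := by rw [whisker_exchange]; unfold pass; monoidal

theorem pass_natural_left {A B : GCenter D} (f : A ⟶ B) (V X U : C)
    (h : D.deg 1 ((V ⊗ X) ⊗ dual U)) :
    (dual V ◁ (f.hom ▷ V)) ▷ X ≫ pass B V X U h =
      pass A V X U h ≫ X ◁ (dual U ◁ (f.hom ▷ U)) := by
  have n := push_natural_left f (V ⊗ X) U h
  calc _ = 𝟙 _ ⊗≫ dual V ◁ (f.hom ▷ (V ⊗ X) ≫ push B (V ⊗ X) U h) ⊗≫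
        ev V ▷ (X ⊗ (dual U ⊗ (B.obj ⊗ U))) ⊗≫ 𝟙 _ := by unfold pass; monoidal
    _ = 𝟙 _ ⊗≫ dual V ◁ push A (V ⊗ X) U h ⊗≫
        ((dual V ⊗ V) ◁ (X ◁ (dual U ◁ (f.hom ▷ U))) ≫
        ev V ▷ (X ⊗ (dual U ⊗ (B.obj ⊗ U)))) ⊗≫ 𝟙 _ := by rw [n]; monoidal
    _ = _ := by rw [whisker_exchange]; unfold pass; monoidal

theorem pass_unit (A : GCenter D) (V U : C) (h : D.deg 1 ((V ⊗ 𝟙_ C) ⊗ dual U))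
    (h0 : D.deg 1 (V ⊗ dual U)) :
    pass A V (𝟙_ C) U h = (ρ_ _).hom ≫ pass₀ A V U h0 ≫ (λ_ _).inv := by
  have n := push_natural A U h h0 (ρ_ V).hom
  have n' : push A (V ⊗ 𝟙_ C) U h = A.obj ◁ (ρ_ V).hom ≫ push A V U h0 ≫ (ρ_ V).inv ▷ _ := by
    rw [reassoc_of% n]; monoidal
  unfold pass; rw [n']; unfold pass₀; monoidal

/-- The basic relation between `push` and `pass`. -/
theorem push_pass (hp : IsPure C) (A : GCenter D) (W V X U : C) (h : D.deg 1 (W ⊗ dual V))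
    (h' : D.deg 1 ((V ⊗ X) ⊗ dual U)) (h'' : D.deg 1 ((W ⊗ X) ⊗ dual U)) :
    push A W V h ▷ X ≫ (α_ _ _ _).hom ≫ W ◁ pass A V X U h' =
      scal (dimL V) ((α_ _ _ _).hom ≫ push A (W ⊗ X) U h'' ≫ (α_ _ _ _).hom) := by
  have hm : D.deg 1 ((W ⊗ dual V) ⊗ ((V ⊗ X) ⊗ dual U)) := D.mem_tensor_one h h'
  have t := A.tensor h h' hm
  let f : (W ⊗ dual V) ⊗ ((V ⊗ X) ⊗ dual U) ⟶ (W ⊗ X) ⊗ dual U :=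
    𝟙 _ ⊗≫ W ◁ (ev V ▷ (X ⊗ dual U)) ⊗≫ 𝟙 _
  have n := A.natural hm h'' f
  calc _ = 𝟙 _ ⊗≫ (A.obj ⊗ W) ◁ coevt V ▷ X ⊗≫
      ((A.braid _ h).hom ▷ (V ⊗ X ⊗ 𝟙_ C) ≫
        ((W ⊗ dual V) ⊗ A.obj) ◁ (V ◁ (X ◁ coevt U))) ⊗≫
        (W ⊗ dual V) ◁ (A.braid _ h').hom ▷ U ⊗≫
        W ◁ (ev V ▷ (X ⊗ (dual U ⊗ (A.obj ⊗ U)))) ⊗≫ 𝟙 _ := by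
        unfold pass push; monoidal
    _ = 𝟙 _ ⊗≫ A.obj ◁ (W ◁ coevt V ▷ X) ⊗≫ (A.obj ⊗ W ⊗ dual V ⊗ V ⊗ X) ◁ coevt U ⊗≫
        (((α_ _ _ _).inv ≫ (A.braid _ h).hom ▷ ((V ⊗ X) ⊗ dual U) ≫ (α_ _ _ _).hom ≫
        (W ⊗ dual V) ◁ (A.braid _ h').hom ≫ (α_ _ _ _).inv) ≫ f ▷ A.obj) ▷ U ⊗≫ 𝟙 _ := by
        rw [← whisker_exchange]; simp only [f]; monoidal
    _ = 𝟙 _ ⊗≫ A.obj ◁ (W ◁ coevt V ▷ X) ⊗≫ ((A.obj ⊗ W) ◁ ((dual V ⊗ V) ◁ (X ◁ coevt U)) ≫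
          (A.obj ⊗ W) ◁ (ev V ▷ (X ⊗ dual U ⊗ U))) ⊗≫ 
        ((A.braid _ h'').hom) ▷ U ⊗≫ 𝟙 _ := by
        rw [← t, ← n]; simp only [f]; monoidal
    _ = 𝟙 _ ⊗≫ (A.obj ⊗ W) ◁ (dimL V ▷ X) ⊗≫ (A.obj ⊗ W ⊗ X) ◁ coevt U ⊗≫
        ((A.braid _ h'').hom) ▷ U ⊗≫ 𝟙 _ := by
        rw [← MonoidalCategory.whiskerLeft_comp, whisker_exchange]; simp only [dimL]; monoidal
    _ = _ := by
        rw [whiskerRight_eq_scal]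
        simp only [hp.whiskerLeft_scal, scal_monoidalComp, monoidalComp_scal]
        congr 1
        unfold push; monoidal

theorem pass_pass (hp : IsPure C) (A : GCenter D) (W V X U Y : C)
    (h : D.deg 1 ((W ⊗ X) ⊗ dual V)) (h' : D.deg 1 ((V ⊗ Y) ⊗ dual U))
    (h'' : D.deg 1 ((W ⊗ (X ⊗ Y)) ⊗ dual U)) (h3 : D.deg 1 (((W ⊗ X) ⊗ Y) ⊗ dual U)) :
    pass A W X V h ▷ Y ≫ (α_ _ _ _).hom ≫ X ◁ pass A V Y U h' =
      scal (dimL V) ((α_ _ _ _).hom ≫ pass A W (X ⊗ Y) U h'' ≫ (α_ _ _ _).hom) := by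
  have m := push_pass hp A (W ⊗ X) V Y U h h' h3
  have n := push_natural A U h3 h'' (α_ W X Y).hom
  calc _ = 𝟙 _ ⊗≫ dual W ◁ push A (W ⊗ X) V h ▷ Y ⊗≫
        (ev W ▷ (X ⊗ ((dual V ⊗ (A.obj ⊗ V)) ⊗ Y)) ≫ 𝟙_ C ◁ (X ◁ pass A V Y U h')) ⊗≫ 𝟙 _ := by
        conv_lhs => arg 1; unfold pass
        monoidal
    _ = 𝟙 _ ⊗≫ dual W ◁ (push A (W ⊗ X) V h ▷ Y ≫ (α_ _ _ _).hom ≫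
          (W ⊗ X) ◁ pass A V Y U h') ⊗≫
        (ev W ▷ (X ⊗ (Y ⊗ (dual U ⊗ (A.obj ⊗ U))))) ⊗≫ 𝟙 _ := by
        rw [← whisker_exchange]; monoidal
    _ = scal (dimL V) (𝟙 _ ⊗≫ dual W ◁ push A ((W ⊗ X) ⊗ Y) U h3 ⊗≫
        (ev W ▷ (X ⊗ (Y ⊗ (dual U ⊗ (A.obj ⊗ U))))) ⊗≫ 𝟙 _) := by
        rw [m]
        simp only [hp.whiskerLeft_scal, scal_monoidalComp, monoidalComp_scal]
        congr 1
        monoidal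
    _ = _ := by
        congr 1
        have n' : push A ((W ⊗ X) ⊗ Y) U h3 =
            A.obj ◁ (α_ W X Y).hom ≫ push A (W ⊗ (X ⊗ Y)) U h'' ≫ (α_ W X Y).inv ▷ _ := by
          rw [reassoc_of% n]; monoidal
        rw [n']; unfold pass; monoidal

/-- The inverse `d_V⁻¹` of the left dimension of `V`. -/
def InvObj.invDim {α : G} (V : InvObj D α) : 𝟙_ C ⟶ 𝟙_ C :=
  have := V.isIso_dim
  inv (dimL V.obj)

theorem InvObj.invDim_dim {α : G} (V : InvObj D α) : V.invDim ≫ dimL V.obj = 𝟙 _ := by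
  have := V.isIso_dim
  simp [InvObj.invDim]

theorem InvObj.dim_invDim {α : G} (V : InvObj D α) : dimL V.obj ≫ V.invDim = 𝟙 _ := by
  have := V.isIso_dim
  simp [InvObj.invDim]

/-- The idempotent `π^V_{(A,σ)} = d_V⁻¹ (ev_V ⊗ id) (V^* ⊗ σ_{V ⊗ V^*} ⊗ V) (id ⊗ coevt_V)` of
`V^* ⊗ A ⊗ V`. -/
def piV {α : G} (V : InvObj D α) (A : GCenter D) :
    dual V.obj ⊗ (A.obj ⊗ V.obj) ⟶ dual V.obj ⊗ (A.obj ⊗ V.obj) :=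
  scal V.invDim (pass₀ A V.obj V.obj (D.mem_tensor_dual V.mem V.mem))

theorem pi_natural {α : G} (V : InvObj D α) {A B : GCenter D} (f : A ⟶ B) :
    piV V A ≫ dual V.obj ◁ (f.hom ▷ V.obj) = dual V.obj ◁ (f.hom ▷ V.obj) ≫ piV V B := by
  have n := pass_natural_left f V.obj (𝟙_ C) V.obj
    (D.mem_tensor_dual (D.mem_tensor_one V.mem D.unit_mem) V.mem)
  rw [pass_unit _ _ _ _ (D.mem_tensor_dual V.mem V.mem),
    pass_unit _ _ _ _ (D.mem_tensor_dual V.mem V.mem)] at n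
  simp only [piV, comp_scal, scal_comp]
  congr 1
  have e : dual V.obj ◁ (f.hom ▷ V.obj) ≫
    pass₀ B V.obj V.obj (D.mem_tensor_dual V.mem V.mem) = (ρ_ _).inv ≫
      ((dual V.obj ◁ (f.hom ▷ V.obj)) ▷ 𝟙_ C ≫ (ρ_ _).hom ≫
      pass₀ B V.obj V.obj (D.mem_tensor_dual V.mem V.mem) ≫ (λ_ _).inv) ≫ (λ_ _).hom := by
    monoidal
  rw [e, n]; monoidal

/-- A choice of a splitting `(E^V_A, p^V_A, q^V_A)` of each of the idempotents `π^V_A`. -/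
abbrev Splittings (D : PivotalGrading G C) :=
  ∀ (α : G) (V : InvObj D α) (A : GCenter D), Splitting (piV V A)

variable (S : Splittings D)

theorem mem_mid {α : G} {V X U : C} (hV : D.deg α V) (hX : D.deg 1 X) (hU : D.deg α U) :
    D.deg 1 ((V ⊗ X) ⊗ dual U) :=
  D.mem_tensor_dual (D.mem_tensor_one hV hX) hU

/-- The morphism `E^V ⊗ X ⟶ X ⊗ E^U` induced by `pass`. -/
def mid {α : G} (V U : InvObj D α) (A : GCenter D) (X : C) (hX : D.deg 1 X) :
    (S α V A).obj ⊗ X ⟶ X ⊗ (S α U A).obj :=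
  (S α V A).q ▷ X ≫ pass A V.obj X U.obj (mem_mid V.mem hX U.mem) ≫ X ◁ (S α U A).p

theorem pi_pass (hp : IsPure C) {α : G} (V U : InvObj D α) (A : GCenter D) (X : C)
    (hX : D.deg 1 X) :
    piV V A ▷ X ≫ pass A V.obj X U.obj (mem_mid V.mem hX U.mem) =
      pass A V.obj X U.obj (mem_mid V.mem hX U.mem) := by
  have h1 := mem_mid V.mem D.unit_mem V.mem
  have h0 := D.mem_tensor_dual V.mem V.mem
  have m := pass_pass hp A V.obj V.obj (𝟙_ C) U.obj X h1 (mem_mid V.mem hX U.mem)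
    (mem_mid V.mem (D.mem_tensor_one D.unit_mem hX) U.mem)
    (D.mem_tensor_dual (D.mem_tensor_one (D.mem_tensor_one V.mem D.unit_mem) hX) U.mem)
  have n := pass_natural_right A V.obj U.obj
    (mem_mid V.mem (D.mem_tensor_one D.unit_mem hX) U.mem) (mem_mid V.mem hX U.mem) (λ_ X).hom
  rw [pass_unit A _ _ h1 h0] at m
  have e : pass₀ A V.obj V.obj h0 ▷ X ≫ pass A V.obj X U.obj (mem_mid V.mem hX U.mem) =
      (ρ_ _).inv ▷ X ≫ (((ρ_ _).hom ≫ pass₀ A V.obj V.obj h0 ≫ (λ_ _).inv) ▷ X ≫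
        (α_ _ _ _).hom ≫ 𝟙_ C ◁ pass A V.obj X U.obj (mem_mid V.mem hX U.mem)) ≫ (λ_ _).hom := by
    monoidal
  rw [piV, scal_whiskerRight, scal_comp, e, m]
  simp only [scal_comp, comp_scal, scal_scal, InvObj.invDim_dim, scal_one]
  have n' : pass A V.obj (𝟙_ C ⊗ X) U.obj
      (mem_mid V.mem (D.mem_tensor_one D.unit_mem hX) U.mem) =
      (dual V.obj ⊗ (A.obj ⊗ V.obj)) ◁ (λ_ X).hom ≫
        pass A V.obj X U.obj (mem_mid V.mem hX U.mem) ≫ (λ_ X).inv ▷ _ := by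
    rw [reassoc_of% n]; monoidal
  rw [n']; monoidal

theorem pass_pi (hp : IsPure C) {α : G} (V U : InvObj D α) (A : GCenter D) (X : C)
    (hX : D.deg 1 X) :
    pass A V.obj X U.obj (mem_mid V.mem hX U.mem) ≫ X ◁ piV U A =
      pass A V.obj X U.obj (mem_mid V.mem hX U.mem) := by
  have h1 := mem_mid U.mem D.unit_mem U.mem
  have h0 := D.mem_tensor_dual U.mem U.mem
  have m := pass_pass hp A V.obj U.obj X U.obj (𝟙_ C) (mem_mid V.mem hX U.mem) h1
    (mem_mid V.mem (D.mem_tensor_one hX D.unit_mem) U.mem)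
    (D.mem_tensor_dual (D.mem_tensor_one (D.mem_tensor_one V.mem hX) D.unit_mem) U.mem)
  have n := pass_natural_right A V.obj U.obj
    (mem_mid V.mem (D.mem_tensor_one hX D.unit_mem) U.mem) (mem_mid V.mem hX U.mem) (ρ_ X).hom
  rw [pass_unit A _ _ h1 h0] at m
  have e : pass A V.obj X U.obj (mem_mid V.mem hX U.mem) ≫ X ◁ pass₀ A U.obj U.obj h0 =
      (ρ_ _).inv ≫ (pass A V.obj X U.obj (mem_mid V.mem hX U.mem) ▷ 𝟙_ C ≫ (α_ _ _ _).hom ≫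
      X ◁ ((ρ_ _).hom ≫ pass₀ A U.obj U.obj h0 ≫ (λ_ _).inv)) ≫ X ◁ (λ_ _).hom := by
    monoidal
  rw [piV, hp.whiskerLeft_scal, comp_scal, e, m]
  simp only [scal_comp, comp_scal, scal_scal, InvObj.invDim_dim, scal_one]
  have n' : pass A V.obj (X ⊗ 𝟙_ C) U.obj
      (mem_mid V.mem (D.mem_tensor_one hX D.unit_mem) U.mem) =
      (dual V.obj ⊗ (A.obj ⊗ V.obj)) ◁ (ρ_ X).hom ≫
        pass A V.obj X U.obj (mem_mid V.mem hX U.mem) ≫ (ρ_ X).inv ▷ _ := by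
    rw [reassoc_of% n]; monoidal
  rw [n']; monoidal

theorem mid_mid (hp : IsPure C) {α : G} (V U T : InvObj D α) (A : GCenter D) {X Y : C}
    (hX : D.deg 1 X) (hY : D.deg 1 Y) (hXY : D.deg 1 (X ⊗ Y)) :
    mid S V U A X hX ▷ Y ≫ (α_ _ _ _).hom ≫ X ◁ mid S U T A Y hY =
      scal (dimL U.obj) ((α_ _ _ _).hom ≫ mid S V T A (X ⊗ Y) hXY ≫ (α_ _ _ _).hom) := by
  have m := pass_pass hp A V.obj U.obj X T.obj Y (mem_mid V.mem hX U.mem)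
    (mem_mid U.mem hY T.mem) (mem_mid V.mem hXY T.mem)
    (D.mem_tensor_dual (D.mem_tensor_one (D.mem_tensor_one V.mem hX) hY) T.mem)
  have c := pi_pass hp U T A Y hY
  calc _ = ((S α V A).q ▷ X) ▷ Y ≫ pass A V.obj X U.obj (mem_mid V.mem hX U.mem) ▷ Y ≫
        (α_ _ _ _).hom ≫
        X ◁ (((S α U A).p ≫ (S α U A).q) ▷ Y ≫ pass A U.obj Y T.obj (mem_mid U.mem hY T.mem)) ≫
        X ◁ (Y ◁ (S α T A).p) := by unfold mid; monoidal
    _ = _ := by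
      rw [(S α U A).p_q, c, reassoc_of% m]
      simp only [scal_comp, comp_scal]
      congr 1
      unfold mid
      monoidal

theorem mid_natural {α : G} (V U : InvObj D α) (A : GCenter D) {X Y : C}
    (hX : D.deg 1 X) (hY : D.deg 1 Y) (f : X ⟶ Y) :
    (S α V A).obj ◁ f ≫ mid S V U A Y hY = mid S V U A X hX ≫ f ▷ (S α U A).obj := by
  have n := pass_natural_right A V.obj U.obj (mem_mid V.mem hX U.mem) (mem_mid V.mem hY U.mem) f
  unfold mid
  rw [whisker_exchange_assoc, reassoc_of% n, Category.assoc, Category.assoc, whisker_exchange]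

theorem mid_natural_left (hp : IsPure C) {α : G} (V U : InvObj D α) {A B : GCenter D}
    (f : A ⟶ B) {X : C} (hX : D.deg 1 X) :
    ((S α V A).q ≫ dual V.obj ◁ (f.hom ▷ V.obj) ≫ (S α V B).p) ▷ X ≫ mid S V U B X hX =
      mid S V U A X hX ≫ X ◁ ((S α U A).q ≫ dual U.obj ◁ (f.hom ▷ U.obj) ≫ (S α U B).p) := by
  have c1 := pi_pass hp V U B X hX
  have c2 := pass_pi hp V U A X hX
  have n := pass_natural_left f V.obj X U.obj (mem_mid V.mem hX U.mem)
  rw [← (S α V B).p_q] at c1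
  rw [← (S α U A).p_q] at c2
  calc _ = (S α V A).q ▷ X ≫ (dual V.obj ◁ (f.hom ▷ V.obj)) ▷ X ≫ (((S α V B).p ≫ (S α V B).q) ▷ X
        ≫ pass B V.obj X U.obj (mem_mid V.mem hX U.mem)) ≫ X ◁ (S α U B).p := by
        unfold mid; monoidal
    _ = (S α V A).q ▷ X ≫ (pass A V.obj X U.obj (mem_mid V.mem hX U.mem) ≫
        X ◁ ((S α U A).p ≫ (S α U A).q)) ≫
        X ◁ (dual U.obj ◁ (f.hom ▷ U.obj)) ≫ X ◁ (S α U B).p := by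
        rw [c1, reassoc_of% n, c2]
    _ = _ := by unfold mid; monoidal

theorem mid_unit {α : G} (V U : InvObj D α) (A : GCenter D) :
    mid S V U A (𝟙_ C) D.unit_mem = (ρ_ _).hom ≫ ((S α V A).q ≫
      pass₀ A V.obj U.obj (D.mem_tensor_dual V.mem U.mem) ≫ (S α U A).p) ≫ (λ_ _).inv := by
  unfold mid
  rw [pass_unit A V.obj U.obj _ (D.mem_tensor_dual V.mem U.mem)]
  simp

/-- The half-braided object `φ_V(A, σ) = (E^V_A, γ^V_A)`, where
`γ^V_X = d_V⁻¹ (X ⊗ p) (ev_V ⊗ id) (V^* ⊗ σ_{V ⊗ X ⊗ V^*} ⊗ V) (id ⊗ coevt_V) (q ⊗ X)`. -/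
def phiObj (hp : IsPure C) {α : G} (V : InvObj D α) (A : GCenter D) : GCenter D :=
  RelCenter.mk' (S α V A).obj (fun X hX => scal V.invDim (mid S V V A X hX))
    D.unit_mem (fun _ h => D.dual_mem_one h) (fun _ _ h h' => D.mem_tensor_one h h')
    (fun hX hY f => by
      rw [comp_scal, scal_comp, mid_natural S V V A hX hY f])
    (fun {X Y} hX hY hXY => by
      have m := mid_mid S hp V V V A hX hY hXY
      simp only [scal_whiskerRight, hp.whiskerLeft_scal, scal_comp, comp_scal, scal_scal]
      have m' : (α_ _ _ _).inv ≫ mid S V V A X hX ▷ Y ≫ (α_ _ _ _).hom ≫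
          X ◁ mid S V V A Y hY ≫ (α_ _ _ _).inv =
          scal (dimL V.obj) (mid S V V A (X ⊗ Y) hXY) := by
        rw [reassoc_of% m]
        simp [scal_comp, comp_scal]
      rw [m', scal_scal, Category.assoc, V.invDim_dim, Category.comp_id])
    (by
      rw [mid_unit]
      have e := (S α V A).q_e_p
      change (S α V A).q ≫ scal V.invDim (pass₀ A V.obj V.obj
        (D.mem_tensor_dual V.mem V.mem)) ≫ (S α V A).p = 𝟙 _ at e
      rw [scal_comp, comp_scal] at e
      rw [← comp_scal, ← scal_comp, e, Category.id_comp])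

/-- The endofunctor `φ_V` of the `G`-center, with `φ_V(f) = p (V^* ⊗ f ⊗ V) q`. -/
def phi (hp : IsPure C) {α : G} (V : InvObj D α) : GCenter D ⥤ GCenter D where
  obj A := phiObj S hp V A
  map {A B} f :=
    { hom := (S α V A).q ≫ dual V.obj ◁ (f.hom ▷ V.obj) ≫ (S α V B).p
      comm := fun X hX => by
        have e : ((S α V A).q ≫ dual V.obj ◁ (f.hom ▷ V.obj) ≫ (S α V B).p) ▷ X ≫
            scal V.invDim (mid S V V B X hX) = scal V.invDim (mid S V V A X hX) ≫
            X ◁ ((S α V A).q ≫ dual V.obj ◁ (f.hom ▷ V.obj) ≫ (S α V B).p) := by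
          rw [comp_scal, scal_comp, mid_natural_left S hp V V f hX]
        exact e }
  map_id A := by
    ext
    change (S α V A).q ≫ dual V.obj ◁ ((𝟙 A.obj) ▷ V.obj) ≫ (S α V A).p = 𝟙 _
    simp [(S α V A).q_p]
  map_comp {A B E} f g := by
    ext
    change (S α V A).q ≫ dual V.obj ◁ ((f.hom ≫ g.hom) ▷ V.obj) ≫ (S α V E).p =
      ((S α V A).q ≫ dual V.obj ◁ (f.hom ▷ V.obj) ≫ (S α V B).p) ≫
      ((S α V B).q ≫ dual V.obj ◁ (g.hom ▷ V.obj) ≫ (S α V E).p)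
    have n2 := reassoc_of% (pi_natural V f)
    calc _ = (S α V A).q ≫ dual V.obj ◁ (f.hom ▷ V.obj) ≫
          dual V.obj ◁ (g.hom ▷ V.obj) ≫ (S α V E).p := by simp
      _ = ((S α V A).q ≫ (S α V A).p) ≫ (S α V A).q ≫ dual V.obj ◁ (f.hom ▷ V.obj) ≫
          dual V.obj ◁ (g.hom ▷ V.obj) ≫ (S α V E).p := by rw [(S α V A).q_p, Category.id_comp]
      _ = (S α V A).q ≫ piV V A ≫ dual V.obj ◁ (f.hom ▷ V.obj) ≫
          dual V.obj ◁ (g.hom ▷ V.obj) ≫ (S α V E).p := by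
          rw [Category.assoc, reassoc_of% (S α V A).p_q]
      _ = (S α V A).q ≫ dual V.obj ◁ (f.hom ▷ V.obj) ≫ ((S α V B).p ≫ (S α V B).q) ≫
          dual V.obj ◁ (g.hom ▷ V.obj) ≫ (S α V E).p := by
          rw [(S α V B).p_q, n2]
      _ = _ := by simp

/-- The morphism `d_V δ^{U,V}`. -/
def delta₀ {α : G} (V U : InvObj D α) (A : GCenter D) : (S α V A).obj ⟶ (S α U A).obj :=
  (S α V A).q ≫ pass₀ A V.obj U.obj (D.mem_tensor_dual V.mem U.mem) ≫ (S α U A).p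

theorem mid_unit' {α : G} (V U : InvObj D α) (A : GCenter D) :
    mid S V U A (𝟙_ C) D.unit_mem = (ρ_ _).hom ≫ delta₀ S V U A ≫ (λ_ _).inv :=
  mid_unit S V U A

theorem delta₀_mid (hp : IsPure C) {α : G} (V U T : InvObj D α) (A : GCenter D) (X : C)
    (hX : D.deg 1 X) :
    delta₀ S V U A ▷ X ≫ mid S U T A X hX = scal (dimL U.obj) (mid S V T A X hX) := by
  have hX' := D.mem_tensor_one D.unit_mem hX
  have m := mid_mid S hp V U T A D.unit_mem hX hX'
  have n := mid_natural S V T A hX' hX (λ_ X).hom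
  have n' : mid S V T A (𝟙_ C ⊗ X) hX' = (S α V A).obj ◁ (λ_ X).hom ≫ mid S V T A X hX ≫
      (λ_ X).inv ▷ _ := by
    rw [reassoc_of% n]; monoidal
  rw [mid_unit', n'] at m
  calc _ = (ρ_ _).inv ▷ X ≫ (((ρ_ _).hom ≫ delta₀ S V U A ≫ (λ_ _).inv) ▷ X ≫ (α_ _ _ _).hom ≫
        𝟙_ C ◁ mid S U T A X hX) ≫ (λ_ _).hom := by monoidal
    _ = _ := by
      rw [m]
      simp only [scal_comp, comp_scal]
      congr 1
      monoidal

theorem mid_delta₀ (hp : IsPure C) {α : G} (V U T : InvObj D α) (A : GCenter D) (X : C)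
    (hX : D.deg 1 X) :
    mid S V U A X hX ≫ X ◁ delta₀ S U T A = scal (dimL U.obj) (mid S V T A X hX) := by
  have hX' := D.mem_tensor_one hX D.unit_mem
  have m := mid_mid S hp V U T A hX D.unit_mem hX'
  have n := mid_natural S V T A hX' hX (ρ_ X).hom
  have n' : mid S V T A (X ⊗ 𝟙_ C) hX' = (S α V A).obj ◁ (ρ_ X).hom ≫ mid S V T A X hX ≫
      (ρ_ X).inv ▷ _ := by
    rw [reassoc_of% n]; monoidal
  rw [mid_unit', n'] at m
  calc _ = (ρ_ _).inv ≫ (mid S V U A X hX ▷ 𝟙_ C ≫ (α_ _ _ _).hom ≫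
        X ◁ ((ρ_ _).hom ≫ delta₀ S U T A ≫ (λ_ _).inv)) ≫ X ◁ (λ_ _).hom := by monoidal
    _ = _ := by
      rw [m]
      simp only [scal_comp, comp_scal]
      congr 1
      monoidal

theorem delta₀_delta₀ (hp : IsPure C) {α : G} (V U T : InvObj D α) (A : GCenter D) :
    delta₀ S V U A ≫ delta₀ S U T A = scal (dimL U.obj) (delta₀ S V T A) := by
  have m := mid_delta₀ S hp V U T A (𝟙_ C) D.unit_mem
  rw [mid_unit', mid_unit'] at m
  calc _ = (ρ_ _).inv ≫ (((ρ_ _).hom ≫ delta₀ S V U A ≫ (λ_ _).inv) ≫ 𝟙_ C ◁ delta₀ S U T A) ≫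
        (λ_ _).hom := by monoidal
    _ = _ := by
      rw [m]
      simp only [scal_comp, comp_scal]
      congr 1
      simp

theorem delta₀_natural (hp : IsPure C) {α : G} (V U : InvObj D α) {A B : GCenter D}
    (f : A ⟶ B) :
    ((S α V A).q ≫ dual V.obj ◁ (f.hom ▷ V.obj) ≫ (S α V B).p) ≫ delta₀ S V U B =
      delta₀ S V U A ≫ ((S α U A).q ≫ dual U.obj ◁ (f.hom ▷ U.obj) ≫ (S α U B).p) := by
  have m := mid_natural_left S hp V U f D.unit_mem
  rw [mid_unit', mid_unit'] at m
  generalize (S α V A).q ≫ dual V.obj ◁ (f.hom ▷ V.obj) ≫ (S α V B).p = g at m ⊢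
  generalize (S α U A).q ≫ dual U.obj ◁ (f.hom ▷ U.obj) ≫ (S α U B).p = g' at m ⊢
  calc _ = (ρ_ _).inv ≫ (g ▷ 𝟙_ C ≫ (ρ_ _).hom ≫ delta₀ S V U B ≫ (λ_ _).inv) ≫
        (λ_ _).hom := by monoidal
    _ = _ := by rw [m]; monoidal

/-- The transition `δ^{U,V} : φ_V ⟶ φ_U`,
`δ^{U,V} = d_V⁻¹ p^U (ev_V ⊗ id) (V^* ⊗ σ_{V ⊗ U^*} ⊗ U) (id ⊗ coevt_U) q^V`. -/
def delta (hp : IsPure C) {α : G} (U V : InvObj D α) : phi S hp V ⟶ phi S hp U where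
  app A :=
    { hom := scal V.invDim ((S α V A).q ≫
        pass₀ A V.obj U.obj (D.mem_tensor_dual V.mem U.mem) ≫ (S α U A).p)
      comm := fun X hX => by
        have e : scal V.invDim (delta₀ S V U A) ▷ X ≫ scal U.invDim (mid S U U A X hX) =
            scal V.invDim (mid S V V A X hX) ≫ X ◁ scal V.invDim (delta₀ S V U A) := by
          simp only [scal_whiskerRight, hp.whiskerLeft_scal, scal_comp, comp_scal]
          rw [delta₀_mid S hp, mid_delta₀ S hp, scal_comm U.invDim V.invDim,
            scal_scal U.invDim, scal_scal V.invDim (dimL _), U.invDim_dim,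
            V.invDim_dim, scal_one]
        exact e }
  naturality A B f := by
    apply RelCenter.hom_ext
    have e : ((S α V A).q ≫ dual V.obj ◁ (f.hom ▷ V.obj) ≫ (S α V B).p) ≫
        scal V.invDim (delta₀ S V U B) = scal V.invDim (delta₀ S V U A) ≫
          ((S α U A).q ≫ dual U.obj ◁ (f.hom ▷ U.obj) ≫ (S α U B).p) := by
      rw [comp_scal, scal_comp, delta₀_natural S hp]
    exact e

theorem delta_comp (hp : IsPure C) {α : G} (U V T : InvObj D α) :
    delta S hp U V ≫ delta S hp T U = delta S hp T V := by
  apply NatTrans.ext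
  funext A
  apply RelCenter.hom_ext
  have e : scal V.invDim (delta₀ S V U A) ≫ scal U.invDim (delta₀ S U T A) =
      scal V.invDim (delta₀ S V T A) := by
    rw [scal_comp, comp_scal, delta₀_delta₀ S hp, scal_scal U.invDim, U.invDim_dim, scal_one]
  exact e

theorem delta_self (hp : IsPure C) {α : G} (V : InvObj D α) :
    delta S hp V V = 𝟙 _ := by
  apply NatTrans.ext
  funext A
  apply RelCenter.hom_ext
  have e := (S α V A).q_e_p
  change (S α V A).q ≫ scal V.invDim (pass₀ A V.obj V.obj
    (D.mem_tensor_dual V.mem V.mem)) ≫ (S α V A).p = 𝟙 _ at e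
  rw [scal_comp, comp_scal] at e
  exact e

/-- The projective system `(φ_V, δ^{U,V})_{U, V ∈ E_α}`. -/
def crossingSystem (hp : IsPure C) (α : G) :
    Codiscrete (InvObj D α) ⥤ (GCenter D ⥤ GCenter D) where
  obj V := phi S hp V.as
  map {V U} _ := delta S hp U.as V.as
  map_id V := delta_self S hp V.as
  map_comp {V U T} _ _ := (delta_comp S hp U.as V.as T.as).symm

/-- A choice, for each `α`, of a projective limit `φ_α` of the system `(φ_V, δ^{U,V})` together
with its universal cone `ι^α_V : φ_α ⟶ φ_V`. -/
abbrev Crossing (hp : IsPure C) := ∀ α : G, LimitCone (crossingSystem S hp α)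

variable {S} {hp : IsPure C}

/-- The endofunctor `φ_α` of the `G`-center. -/
abbrev Crossing.functor (L : Crossing S hp) (α : G) : GCenter D ⥤ GCenter D :=
  (L α).cone.pt

/-- The universal cone `ι^α_V : φ_α ⟶ φ_V`. -/
abbrev Crossing.ι (L : Crossing S hp) {α : G} (V : InvObj D α) : L.functor α ⟶ phi S hp V :=
  (L α).cone.π.app ⟨V⟩

theorem Crossing.ι_delta (L : Crossing S hp) {α : G} (U V : InvObj D α) :
    L.ι V ≫ delta S hp U V = L.ι U :=
  (L α).cone.w (j := ⟨V⟩) (j' := ⟨U⟩) default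

theorem Crossing.isIso_ι (L : Crossing S hp) {α : G} (V : InvObj D α) : IsIso (L.ι V) := by
  have hV : IsInitial (⟨V⟩ : Codiscrete (InvObj D α)) :=
    IsInitial.ofUniqueHom (fun _ => default) (fun _ _ => rfl)
  let l : phi S hp V ⟶ L.functor α := (L α).isLimit.lift (coneOfDiagramInitial hV _)
  have hl (U : InvObj D α) : l ≫ L.ι U = delta S hp U V :=
    (L α).isLimit.fac (coneOfDiagramInitial hV _) ⟨U⟩
  refine ⟨l, (L α).isLimit.hom_ext fun U => ?_, (hl V).trans (delta_self S hp V)⟩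
  change (L.ι V ≫ l) ≫ L.ι U.as = 𝟙 _ ≫ L.ι U.as
  rw [Category.assoc, hl, Category.id_comp]
  exact L.ι_delta U.as V

theorem Crossing.isIso_ι_app (L : Crossing S hp) {α : G} (V : InvObj D α) (A : GCenter D) :
    IsIso ((L.ι V).app A).hom := by
  have := L.isIso_ι V
  infer_instance

/-- The morphism `Γ^V_{A,X} = (X ⊗ p^V_A) (σ_{X ⊗ V^*} ⊗ V) (A ⊗ X ⊗ coevt_V)`, for `X ∈ C_α` and
`V ∈ E_α`. -/
def Gam (S : Splittings D) {α : G} (V : InvObj D α) (A : GCenter D) (X : C) (hX : D.deg α X) :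
    A.obj ⊗ X ⟶ X ⊗ (S α V A).obj :=
  push A X V.obj (D.mem_tensor_dual hX V.mem) ≫ X ◁ (S α V A).p

theorem push_pass₀ (hp : IsPure C) (A : GCenter D) (W V U : C) (h : D.deg 1 (W ⊗ dual V))
    (h' : D.deg 1 (V ⊗ dual U)) (h'' : D.deg 1 (W ⊗ dual U))
    (h1 : D.deg 1 ((V ⊗ 𝟙_ C) ⊗ dual U)) (h2 : D.deg 1 ((W ⊗ 𝟙_ C) ⊗ dual U)) :
    push A W V h ≫ W ◁ pass₀ A V U h' = scal (dimL V) (push A W U h'') := by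
  have m := push_pass hp A W V (𝟙_ C) U h h1 h2
  have n := push_natural A U h2 h'' (ρ_ W).hom
  have n' : push A (W ⊗ 𝟙_ C) U h2 = A.obj ◁ (ρ_ W).hom ≫ push A W U h'' ≫ (ρ_ W).inv ▷ _ := by
    rw [reassoc_of% n]; monoidal
  rw [pass_unit A V U h1 h', n'] at m
  calc _ = (ρ_ _).inv ≫ (push A W V h ▷ 𝟙_ C ≫ (α_ _ _ _).hom ≫
        W ◁ ((ρ_ _).hom ≫ pass₀ A V U h' ≫ (λ_ _).inv)) ≫ W ◁ (λ_ _).hom := by monoidal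
    _ = _ := by
      rw [m]
      simp only [scal_comp, comp_scal]
      congr 1
      monoidal

theorem Gam_delta₀ (hp : IsPure C) {α : G} (V U : InvObj D α) (A : GCenter D) (X : C)
    (hX : D.deg α X) :
    Gam S V A X hX ≫ X ◁ delta₀ S V U A = scal (dimL V.obj) (Gam S U A X hX) := by
  have hV := D.mem_tensor_dual hX V.mem
  have hU := D.mem_tensor_dual hX U.mem
  have m (T : InvObj D α) := push_pass₀ hp A X V.obj T.obj hV (D.mem_tensor_dual V.mem T.mem)
    (D.mem_tensor_dual hX T.mem) (mem_mid V.mem D.unit_mem T.mem) (mem_mid hX D.unit_mem T.mem)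
  have m' : push A X V.obj hV ≫ X ◁ piV V A = push A X V.obj hV := by
    rw [piV, hp.whiskerLeft_scal, comp_scal, m, scal_scal, V.invDim_dim, scal_one]
  calc _ = (push A X V.obj hV ≫ X ◁ ((S α V A).p ≫ (S α V A).q)) ≫
        X ◁ pass₀ A V.obj U.obj (D.mem_tensor_dual V.mem U.mem) ≫ X ◁ (S α U A).p := by
        unfold Gam delta₀; simp
    _ = _ := by
        rw [(S α V A).p_q, m', reassoc_of% (m U), scal_comp]; rfl

theorem exists_tau (hn : NonSingular D) (L : Crossing S hp) {α : G} (A : GCenter D) (X : C)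
    (hX : D.deg α X) :
    ∃! t : A.obj ⊗ X ⟶ X ⊗ ((L.functor α).obj A).obj,
      ∀ V : InvObj D α, t ≫ X ◁ ((L.ι V).app A).hom = Gam S V A X hX := by
  refine existsUnique_lift X (fun V : InvObj D α => (S α V A).obj) (fun V => ((L.ι V).app A).hom)
    (fun V => L.isIso_ι_app V A) (fun V U => scal V.invDim (delta₀ S V U A)) (fun V U => ?_)
    (fun V => Gam S V A X hX) (fun V U => ?_) (hn.exists_inv α)
  · rw [← L.ι_delta U V]; rfl
  · rw [hp.whiskerLeft_scal, comp_scal, Gam_delta₀ hp, scal_scal, V.invDim_dim, scal_one]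

/-- The enhanced `G`-braiding `τ_{A,X} : A ⊗ X ⟶ X ⊗ φ_α(A)` for `A` in the `G`-center and
`X ∈ C_α`: the unique morphism such that `(X ⊗ (ι^α_V)_A) τ_{A,X} = Γ^V_{A,X}` for all
`V ∈ E_α`. -/
def tau (hn : NonSingular D) (L : Crossing S hp) {α : G} (A : GCenter D) (X : C)
    (hX : D.deg α X) : A.obj ⊗ X ⟶ X ⊗ ((L.functor α).obj A).obj :=
  (exists_tau hn L A X hX).choose

theorem tau_ι (hn : NonSingular D) (L : Crossing S hp) {α : G} (A : GCenter D) (X : C)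
    (hX : D.deg α X) (V : InvObj D α) :
    tau hn L A X hX ≫ X ◁ ((L.ι V).app A).hom = Gam S V A X hX :=
  (exists_tau hn L A X hX).choose_spec.1 V

end Crossing

end

end GCat

namespace GCat

noncomputable section

section Centralizer

variable {C : Type u} [Category.{v} C] [MonoidalCategory C] [PivotalCategory C]

theorem dualMap_id (X : C) : dualMap (𝟙 X) = 𝟙 (dual X) :=
  letI (X : C) : HasRightDual X := ⟨dual X⟩
  rightAdjointMate_id

theorem dualMap_comp {X Y Z : C} (f : X ⟶ Y) (g : Y ⟶ Z) :
    dualMap (f ≫ g) = dualMap g ≫ dualMap f :=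
  letI (X : C) : HasRightDual X := ⟨dual X⟩
  comp_rightAdjointMate

theorem coev_dualMap {X Y : C} (f : X ⟶ Y) :
    coev Y ≫ Y ◁ dualMap f = coev X ≫ f ▷ dual X :=
  letI (X : C) : HasRightDual X := ⟨dual X⟩
  coevaluation_comp_rightAdjointMate f

theorem dualMap_ev {X Y : C} (f : X ⟶ Y) :
    dualMap f ▷ X ≫ ev X = dual Y ◁ f ≫ ev Y :=
  letI (X : C) : HasRightDual X := ⟨dual X⟩
  rightAdjointMate_comp_evaluation f

variable (P : ObjectProperty C)

/-- The functor `(Y, Y') ↦ Y^* ⊗ X ⊗ Y'` on the full subcategory given by `P`. -/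
def conjFunctor (X : C) : P.FullSubcategoryᵒᵖ ⥤ P.FullSubcategory ⥤ C where
  obj Y :=
    { obj Y' := dual Y.unop.obj ⊗ (X ⊗ Y'.obj)
      map f := dual Y.unop.obj ◁ (X ◁ f.hom) }
  map f :=
    { app Y' := dualMap f.unop.hom ▷ (X ⊗ Y'.obj)
      naturality Y' Y'' g := by
        have e := whisker_exchange (dualMap f.unop.hom) (X ◁ g.hom)
        exact e }
  map_id Y := by
    ext Y'
    change dualMap (𝟙 Y.unop.obj) ▷ (X ⊗ Y'.obj) = 𝟙 _
    rw [dualMap_id, id_whiskerRight]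
  map_comp f g := by
    ext Y'
    change dualMap (g.unop.hom ≫ f.unop.hom) ▷ (X ⊗ Y'.obj) =
      dualMap f.unop.hom ▷ (X ⊗ Y'.obj) ≫ dualMap g.unop.hom ▷ (X ⊗ Y'.obj)
    rw [dualMap_comp, comp_whiskerRight]

/-- A centralizer relative to the full subcategory given by `P`: a choice, for each object `X`
of `C`, of a coend `Z(X)` of the functor `(Y, Y') ↦ Y^* ⊗ X ⊗ Y'`, where `Y`, `Y'` satisfy `P`. -/
structure Centralizer where
  cowedge (X : C) : Cowedge (conjFunctor P X)
  isColimit (X : C) : IsColimit (cowedge X)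

namespace Centralizer

variable {P} (Z : Centralizer P)

/-- The object `Z(X)`. -/
def obj (X : C) : C := (Z.cowedge X).pt

/-- The universal dinatural transformation `ρ_{X,Y} : Y^* ⊗ X ⊗ Y ⟶ Z(X)`. -/
def rho (X Y : C) (hY : P Y) : dual Y ⊗ (X ⊗ Y) ⟶ Z.obj X := (Z.cowedge X).π ⟨Y, hY⟩

/-- The morphism `∂_{X,Y} = (Y ⊗ ρ_{X,Y}) (coev_Y ⊗ X ⊗ Y) : X ⊗ Y ⟶ Y ⊗ Z(X)`. -/
def part (X Y : C) (hY : P Y) : X ⊗ Y ⟶ Y ⊗ Z.obj X :=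
  (λ_ _).inv ≫ coev Y ▷ (X ⊗ Y) ≫ (α_ _ _ _).hom ≫ Y ◁ Z.rho X Y hY

theorem rho_dinatural (X : C) {Y Y' : C} (hY : P Y) (hY' : P Y') (f : Y ⟶ Y') :
    dualMap f ▷ (X ⊗ Y) ≫ Z.rho X Y hY = dual Y' ◁ (X ◁ f) ≫ Z.rho X Y' hY' :=
  (Z.cowedge X).condition (i := ⟨Y, hY⟩) (j := ⟨Y', hY'⟩) (ObjectProperty.homMk f)

theorem rho_eq (X Y : C) (hY : P Y) :
    Z.rho X Y hY = dual Y ◁ Z.part X Y hY ≫ (α_ _ _ _).inv ≫ ev Y ▷ Z.obj X ≫ (λ_ _).hom := by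
  symm
  calc _ = 𝟙 _ ⊗≫ dual Y ◁ coev Y ▷ (X ⊗ Y) ⊗≫ ((dual Y ⊗ Y) ◁ Z.rho X Y hY ≫ ev Y ▷ Z.obj X) ⊗≫
        𝟙 _ := by unfold part; monoidal
    _ = 𝟙 _ ⊗≫ (dual Y ◁ coev Y ⊗≫ ev Y ▷ dual Y) ▷ (X ⊗ Y) ⊗≫ Z.rho X Y hY := by
        rw [whisker_exchange]; monoidal
    _ = _ := by rw [ExactPairing.coevaluation_evaluation'']; monoidal

theorem part_natural (X : C) {Y Y' : C} (hY : P Y) (hY' : P Y') (f : Y ⟶ Y') :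
    X ◁ f ≫ Z.part X Y' hY' = Z.part X Y hY ≫ f ▷ Z.obj X := by
  have n := Z.rho_dinatural X hY hY' f
  have c := coev_dualMap f
  symm
  calc _ = (λ_ _).inv ≫ coev Y ▷ (X ⊗ Y) ≫ (α_ _ _ _).hom ≫ (Y ◁ Z.rho X Y hY ≫
        f ▷ Z.obj X) := by unfold part; simp
    _ = (λ_ _).inv ≫ (coev Y ≫ f ▷ dual Y) ▷ (X ⊗ Y) ≫ (α_ _ _ _).hom ≫ Y' ◁ Z.rho X Y hY := by
        rw [whisker_exchange]; monoidal
    _ = (λ_ _).inv ≫ coev Y' ▷ (X ⊗ Y) ≫ (α_ _ _ _).hom ≫ Y' ◁ (dualMap f ▷ (X ⊗ Y) ≫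
          Z.rho X Y hY) := by
        rw [← c]; monoidal
    _ = 𝟙 _ ⊗≫ (coev Y' ▷ (X ⊗ Y) ≫ (Y' ⊗ dual Y') ◁ (X ◁ f)) ⊗≫ Y' ◁ Z.rho X Y' hY' := by
        rw [n]; monoidal
    _ = _ := by
        rw [← whisker_exchange]; unfold part; monoidal

theorem existsUnique (X B : C) (s : ∀ Y, P Y → (X ⊗ Y ⟶ Y ⊗ B))
    (hs : ∀ (Y Y' : C) (hY : P Y) (hY' : P Y') (f : Y ⟶ Y'),
      X ◁ f ≫ s Y' hY' = s Y hY ≫ f ▷ B) :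
    ∃! r : Z.obj X ⟶ B, ∀ (Y : C) (hY : P Y), Z.part X Y hY ≫ Y ◁ r = s Y hY := by
  let d (Y : C) (hY : P Y) : dual Y ⊗ (X ⊗ Y) ⟶ B :=
    dual Y ◁ s Y hY ≫ (α_ _ _ _).inv ≫ ev Y ▷ B ≫ (λ_ _).hom
  have hd {Y Y' : C} (hY : P Y) (hY' : P Y') (f : Y ⟶ Y') :
      dualMap f ▷ (X ⊗ Y) ≫ d Y hY = dual Y' ◁ (X ◁ f) ≫ d Y' hY' := by
    calc _ = (dualMap f ▷ (X ⊗ Y) ≫ dual Y ◁ s Y hY) ≫ (α_ _ _ _).inv ≫ ev Y ▷ B ≫ (λ_ _).hom := by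
          simp [d]
      _ = dual Y' ◁ s Y hY ≫ (α_ _ _ _).inv ≫ (dualMap f ▷ Y ≫ ev Y) ▷ B ≫ (λ_ _).hom := by
          rw [← whisker_exchange]; monoidal
      _ = dual Y' ◁ (s Y hY ≫ f ▷ B) ≫ (α_ _ _ _).inv ≫ ev Y' ▷ B ≫ (λ_ _).hom := by
          rw [dualMap_ev]; monoidal
      _ = _ := by rw [← hs Y Y' hY hY' f]; simp [d]
  have key (r : Z.obj X ⟶ B) (Y : C) (hY : P Y) :
      Z.part X Y hY ≫ Y ◁ r = s Y hY ↔ Z.rho X Y hY ≫ r = d Y hY := by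
    constructor
    · intro h
      simp only [d]
      rw [← h, rho_eq]
      calc _ = dual Y ◁ Z.part X Y hY ≫ (α_ _ _ _).inv ≫ (ev Y ▷ Z.obj X ≫ 𝟙_ C ◁ r) ≫
            (λ_ _).hom := by monoidal
        _ = _ := by rw [← whisker_exchange]; monoidal
    · intro h
      calc _ = (λ_ _).inv ≫ coev Y ▷ (X ⊗ Y) ≫ (α_ _ _ _).hom ≫ Y ◁ (Z.rho X Y hY ≫ r) := by
            unfold part; simp
        _ = 𝟙 _ ⊗≫ (coev Y ▷ (X ⊗ Y) ≫ (Y ⊗ dual Y) ◁ s Y hY) ⊗≫ Y ◁ (ev Y ▷ B) ⊗≫ 𝟙 _ := by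
            rw [h]; simp only [d]; monoidal
        _ = 𝟙 _ ⊗≫ s Y hY ⊗≫ (coev Y ▷ Y ⊗≫ Y ◁ ev Y) ▷ B ⊗≫ 𝟙 _ := by
            rw [← whisker_exchange]; monoidal
        _ = _ := by rw [ExactPairing.evaluation_coevaluation'']; monoidal
  let r : Z.obj X ⟶ B := Cowedge.IsColimit.desc (Z.isColimit X)
    (fun Y => d Y.obj Y.property) (fun Y Y' f => hd Y.property Y'.property f.hom)
  have hr (Y : C) (hY : P Y) : Z.rho X Y hY ≫ r = d Y hY :=
    Cowedge.IsColimit.π_desc (Z.isColimit X) (fun Y => d Y.obj Y.property)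
      (fun Y Y' f => hd Y.property Y'.property f.hom) ⟨Y, hY⟩
  refine ⟨r, fun Y hY => (key r Y hY).2 (hr Y hY), fun r' h' => ?_⟩
  refine Cowedge.IsColimit.hom_ext (Z.isColimit X) fun Y => ?_
  exact ((key r' _ _).1 (h' Y.obj Y.property)).trans (hr Y.obj Y.property).symm

theorem transpose_def {A Q B : C} (f : A ⊗ Q ⟶ B) :
    tensorRightHomEquiv A Q (dual Q) B f =
      (ρ_ _).inv ≫ _ ◁ coev Q ≫ (α_ _ _ _).inv ≫ f ▷ _ := rfl

theorem transpose_eq {A Y E Q B : C} (h : A ⟶ Y ⊗ E) (r : E ⊗ Q ⟶ B) :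
    tensorRightHomEquiv A Q (dual Q) (Y ⊗ B) (h ▷ Q ≫ (α_ _ _ _).hom ≫ Y ◁ r) =
      h ≫ Y ◁ (tensorRightHomEquiv E Q (dual Q) B r) ≫ (α_ _ _ _).inv := by
  rw [transpose_def, transpose_def]
  calc _ = 𝟙 _ ⊗≫ (A ◁ coev Q ≫ h ▷ (Q ⊗ dual Q)) ⊗≫ Y ◁ (r ▷ dual Q) ⊗≫ 𝟙 _ := by monoidal
    _ = _ := by rw [whisker_exchange]; monoidal

theorem existsUnique_param (X Q B : C) (s : ∀ Y, P Y → ((X ⊗ Y) ⊗ Q ⟶ Y ⊗ B))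
    (hs : ∀ (Y Y' : C) (hY : P Y) (hY' : P Y') (f : Y ⟶ Y'),
      (X ◁ f) ▷ Q ≫ s Y' hY' = s Y hY ≫ f ▷ B) :
    ∃! r : Z.obj X ⊗ Q ⟶ B, ∀ (Y : C) (hY : P Y),
      Z.part X Y hY ▷ Q ≫ (α_ _ _ _).hom ≫ Y ◁ r = s Y hY := by
  obtain ⟨r', h1, h2⟩ := Z.existsUnique X (B ⊗ dual Q)
    (fun Y hY => tensorRightHomEquiv (X ⊗ Y) Q (dual Q) (Y ⊗ B) (s Y hY) ≫ (α_ _ _ _).hom)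
    (fun Y Y' hY hY' f => by
      have := hs Y Y' hY hY' f
      rw [transpose_def, transpose_def]
      calc _ = 𝟙 _ ⊗≫ ((X ◁ f) ▷ 𝟙_ C ≫ (X ⊗ Y') ◁ coev Q) ⊗≫ s Y' hY' ▷ dual Q ⊗≫ 𝟙 _ := by
            monoidal
        _ = 𝟙 _ ⊗≫ ((X ⊗ Y) ◁ coev Q) ⊗≫ ((X ◁ f) ▷ Q ≫ s Y' hY') ▷ dual Q ⊗≫ 𝟙 _ := by
            rw [← whisker_exchange]; monoidal
        _ = _ := by rw [this]; monoidal)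
  have key (r : Z.obj X ⊗ Q ⟶ B) (Y : C) (hY : P Y) :
      Z.part X Y hY ▷ Q ≫ (α_ _ _ _).hom ≫ Y ◁ r = s Y hY ↔
      Z.part X Y hY ≫ Y ◁ (tensorRightHomEquiv (Z.obj X) Q (dual Q) B r) =
        tensorRightHomEquiv (X ⊗ Y) Q (dual Q) (Y ⊗ B) (s Y hY) ≫ (α_ _ _ _).hom := by
    rw [← (tensorRightHomEquiv (X ⊗ Y) Q (dual Q) (Y ⊗ B)).apply_eq_iff_eq, transpose_eq,
      ← Category.assoc, Iso.comp_inv_eq]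
  refine ⟨(tensorRightHomEquiv (Z.obj X) Q (dual Q) B).symm r', fun Y hY => ?_, fun r hr => ?_⟩
  · rw [key, Equiv.apply_symm_apply]; exact h1 Y hY
  · rw [Equiv.eq_symm_apply]
    exact h2 _ fun Y hY => (key r Y hY).1 (hr Y hY)

theorem param_ext {X Q B : C} {r r' : Z.obj X ⊗ Q ⟶ B} (h : ∀ (Y : C) (hY : P Y),
    Z.part X Y hY ▷ Q ≫ (α_ _ _ _).hom ≫ Y ◁ r =
      Z.part X Y hY ▷ Q ≫ (α_ _ _ _).hom ≫ Y ◁ r') : r = r' := by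
  refine (Z.existsUnique_param X Q B
    (fun Y hY => Z.part X Y hY ▷ Q ≫ (α_ _ _ _).hom ≫ Y ◁ r')
    (fun Y Y' hY hY' f => ?_)).unique h (fun _ _ => rfl)
  have n := Z.part_natural X hY hY' f
  calc _ = (X ◁ f ≫ Z.part X Y' hY') ▷ Q ≫ (α_ _ _ _).hom ≫ Y' ◁ r' := by monoidal
    _ = Z.part X Y hY ▷ Q ≫ (α_ _ _ _).hom ≫ (f ▷ _ ≫ Y' ◁ r') := by rw [n]; monoidal
    _ = _ := by rw [← whisker_exchange]; monoidal

end Centralizer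

end Centralizer

end

end GCat

namespace GCat

noncomputable section

section Free

variable {G : Type w} [Group G] {C : Type u} [Category.{v} C] [MonoidalCategory C]
  [PivotalCategory C] [Preadditive C] [HasFiniteBiproducts C] {D : PivotalGrading G C}

theorem PivotalGrading.mem_tensor_eq (D : PivotalGrading G C) {α β γ : G} (h : α * β = γ) {X Y : C}
    (hX : D.deg α X) (hY : D.deg β Y) : D.deg γ (X ⊗ Y) :=
  D.mem_cast (D.tensor_mem hX hY) h

variable (Z : ∀ α : G, Centralizer (D.deg α))

theorem existsUnique_mix {α β γ : G} (h : α * β = γ) (X Y : C) (hY : D.deg β Y) :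
    ∃! r : (Z α).obj X ⊗ Y ⟶ Y ⊗ (Z γ).obj X, ∀ (W : C) (hW : D.deg α W),
      (Z α).part X W hW ▷ Y ≫ (α_ _ _ _).hom ≫ W ◁ r =
        (α_ _ _ _).hom ≫ (Z γ).part X (W ⊗ Y) (D.mem_tensor_eq h hW hY) ≫ (α_ _ _ _).hom :=
  (Z α).existsUnique_param X Y (Y ⊗ (Z γ).obj X)
    (fun W hW => (α_ _ _ _).hom ≫ (Z γ).part X (W ⊗ Y) (D.mem_tensor_eq h hW hY) ≫ (α_ _ _ _).hom)
    (fun W W' hW hW' f => by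
      have n := (Z γ).part_natural X (D.mem_tensor_eq h hW hY) (D.mem_tensor_eq h hW' hY) (f ▷ Y)
      calc _ = (α_ _ _ _).hom ≫ (X ◁ (f ▷ Y) ≫ (Z γ).part X (W' ⊗ Y) (D.mem_tensor_eq h hW' hY)) ≫
            (α_ _ _ _).hom := by monoidal
        _ = _ := by rw [n]; monoidal)

/-- The morphism `(Y ⊗ Z_2(β,α)_X) ∂^β_{Z_α(X),Y} : Z_α(X) ⊗ Y ⟶ Y ⊗ Z_{αβ}(X)` -/
def mix {α β γ : G} (h : α * β = γ) (X Y : C) (hY : D.deg β Y) :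
    (Z α).obj X ⊗ Y ⟶ Y ⊗ (Z γ).obj X :=
  (existsUnique_mix Z h X Y hY).choose

theorem mix_spec {α β γ : G} (h : α * β = γ) (X Y : C) (hY : D.deg β Y) (W : C)
    (hW : D.deg α W) : (Z α).part X W hW ▷ Y ≫ (α_ _ _ _).hom ≫ W ◁ mix Z h X Y hY =
      (α_ _ _ _).hom ≫ (Z γ).part X (W ⊗ Y) (D.mem_tensor_eq h hW hY) ≫ (α_ _ _ _).hom :=
  (existsUnique_mix Z h X Y hY).choose_spec.1 W hW

theorem mix_natural {α β γ : G} (h : α * β = γ) (X : C) {Y Y' : C} (hY : D.deg β Y)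
    (hY' : D.deg β Y') (f : Y ⟶ Y') :
    (Z α).obj X ◁ f ≫ mix Z h X Y' hY' = mix Z h X Y hY ≫ f ▷ (Z γ).obj X := by
  refine (Z α).param_ext fun W hW => ?_
  have n := (Z γ).part_natural X (D.mem_tensor_eq h hW hY) (D.mem_tensor_eq h hW hY') (W ◁ f)
  calc _ = ((Z α).part X W hW ▷ Y ≫ (W ⊗ (Z α).obj X) ◁ f) ≫ (α_ _ _ _).hom ≫
        W ◁ mix Z h X Y' hY' := by monoidal
    _ = (X ⊗ W) ◁ f ≫ ((Z α).part X W hW ▷ Y' ≫ (α_ _ _ _).hom ≫ W ◁ mix Z h X Y' hY') := by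
        rw [← whisker_exchange]; monoidal
    _ = (α_ _ _ _).hom ≫ (X ◁ (W ◁ f) ≫
        (Z γ).part X (W ⊗ Y') (D.mem_tensor_eq h hW hY')) ≫ (α_ _ _ _).hom := by
        rw [mix_spec]; monoidal
    _ = ((α_ _ _ _).hom ≫ (Z γ).part X (W ⊗ Y) (D.mem_tensor_eq h hW hY) ≫ (α_ _ _ _).hom) ≫
        W ◁ (f ▷ (Z γ).obj X) := by rw [n]; monoidal
    _ = _ := by rw [← mix_spec Z h X Y hY W hW]; monoidal

theorem mix_mix {α β γ β' δ ε : G} (h : α * β = γ) (h' : γ * β' = δ) (h'' : α * ε = δ) (X : C)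
    {Y Y' : C} (hY : D.deg β Y) (hY' : D.deg β' Y') (hYY : D.deg ε (Y ⊗ Y')) :
    mix Z h X Y hY ▷ Y' ≫ (α_ _ _ _).hom ≫ Y ◁ mix Z h' X Y' hY' =
      (α_ _ _ _).hom ≫ mix Z h'' X (Y ⊗ Y') hYY ≫ (α_ _ _ _).hom := by
  have key : (α_ _ _ _).inv ≫ mix Z h X Y hY ▷ Y' ≫ (α_ _ _ _).hom ≫ Y ◁ mix Z h' X Y' hY' ≫
      (α_ _ _ _).inv = mix Z h'' X (Y ⊗ Y') hYY := by
    refine (Z α).param_ext fun W hW => ?_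
    have hWY := D.mem_tensor_eq h hW hY
    have n := (Z δ).part_natural X (D.mem_tensor_eq h' hWY hY') (D.mem_tensor_eq h'' hW hYY)
      (α_ W Y Y').hom
    calc _ = (α_ _ _ _).inv ≫ ((Z α).part X W hW ▷ Y ≫ (α_ _ _ _).hom ≫ W ◁ mix Z h X Y hY) ▷ Y' ≫
          (α_ _ _ _).hom ≫ W ◁ (α_ _ _ _).hom ≫ W ◁ (Y ◁ mix Z h' X Y' hY') ≫
          W ◁ (α_ _ _ _).inv := by monoidal
      _ = (α_ _ _ _).inv ≫ (α_ _ _ _).hom ▷ Y' ≫ ((Z γ).part X (W ⊗ Y) hWY ▷ Y' ≫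
          (α_ _ _ _).hom ≫ (W ⊗ Y) ◁ mix Z h' X Y' hY') ≫ (α_ _ _ _).hom ≫
          W ◁ (α_ _ _ _).inv := by rw [mix_spec]; monoidal
      _ = (α_ _ _ _).inv ≫ (α_ _ _ _).hom ▷ Y' ≫ (α_ _ _ _).hom ≫
          ((Z δ).part X ((W ⊗ Y) ⊗ Y') (D.mem_tensor_eq h' hWY hY') ≫ (α_ W Y Y').hom ▷ _) ≫
          (α_ _ _ _).hom := by rw [mix_spec]; monoidal
      _ = _ := by rw [← n, mix_spec]; monoidal
  rw [← key]; monoidal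

theorem mix_unit {α : G} (h : α * 1 = α) (X : C) :
    mix Z h X (𝟙_ C) D.unit_mem = (ρ_ _).hom ≫ (λ_ _).inv := by
  refine (Z α).param_ext fun W hW => ?_
  have n := (Z α).part_natural X (D.mem_tensor_eq h hW D.unit_mem) hW (ρ_ W).hom
  have n' : (Z α).part X (W ⊗ 𝟙_ C) (D.mem_tensor_eq h hW D.unit_mem) =
      X ◁ (ρ_ W).hom ≫ (Z α).part X W hW ≫ (ρ_ W).inv ▷ _ := by
    rw [reassoc_of% n]; monoidal
  rw [mix_spec, n']; monoidal

theorem existsUnique_Z2 {α β γ : G} (h : β * α = γ) (X : C) :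
    ∃! r : (Z α).obj ((Z β).obj X) ⟶ (Z γ).obj X, ∀ (Y Y' : C) (hY : D.deg α Y)
      (hY' : D.deg β Y'), (Z β).part X Y' hY' ▷ Y ≫ (α_ _ _ _).hom ≫
        Y' ◁ ((Z α).part ((Z β).obj X) Y hY ≫ Y ◁ r) =
      (α_ _ _ _).hom ≫ (Z γ).part X (Y' ⊗ Y) (D.mem_tensor_eq h hY' hY) ≫ (α_ _ _ _).hom := by
  obtain ⟨r, h1, h2⟩ := (Z α).existsUnique ((Z β).obj X) ((Z γ).obj X)
    (fun Y hY => mix Z h X Y hY) (fun Y Y' hY hY' f => mix_natural Z h X hY hY' f)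
  refine ⟨r, fun Y Y' hY hY' => ?_, fun r' hr' => h2 _ fun Y hY => ?_⟩
  · rw [h1 Y hY, mix_spec]
  · refine (Z β).param_ext fun Y' hY' => ?_
    rw [hr' Y Y' hY hY', mix_spec]

/-- The morphism `Z_2(α,β)_X : Z_α(Z_β(X)) ⟶ Z_γ(X)`, where `γ = βα`: the unique one such that
`(Y' ⊗ ((Y ⊗ Z_2(α,β)_X) ∂^α_{Z_β(X),Y})) (∂^β_{X,Y'} ⊗ Y) = ∂^γ_{X,Y' ⊗ Y}` for all `Y ∈ C_α` and
`Y' ∈ C_β`. -/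
def Z2 {α β γ : G} (h : β * α = γ) (X : C) : (Z α).obj ((Z β).obj X) ⟶ (Z γ).obj X :=
  (existsUnique_Z2 Z h X).choose

theorem Z2_spec {α β γ : G} (h : β * α = γ) (X Y Y' : C) (hY : D.deg α Y) (hY' : D.deg β Y') :
    (Z β).part X Y' hY' ▷ Y ≫ (α_ _ _ _).hom ≫
        Y' ◁ ((Z α).part ((Z β).obj X) Y hY ≫ Y ◁ Z2 Z h X) =
      (α_ _ _ _).hom ≫ (Z γ).part X (Y' ⊗ Y) (D.mem_tensor_eq h hY' hY) ≫ (α_ _ _ _).hom :=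
  (existsUnique_Z2 Z h X).choose_spec.1 Y Y' hY hY'

theorem part_Z2 {α β γ : G} (h : β * α = γ) (X Y : C) (hY : D.deg α Y) :
    (Z α).part ((Z β).obj X) Y hY ≫ Y ◁ Z2 Z h X = mix Z h X Y hY :=
  (Z β).param_ext fun Y' hY' => by rw [Z2_spec, mix_spec]

/-- The free object `F_α(X) = (Z_α(X), σ^α_X)` of the `G`-center, where
`σ^α_{X,Y} = (Y ⊗ Z_2(1,α)_X) ∂^1_{Z_α(X),Y}`. -/
def free (α : G) (X : C) : GCenter D :=
  RelCenter.mk' ((Z α).obj X)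
    (fun Y hY => (Z 1).part ((Z α).obj X) Y hY ≫ Y ◁ Z2 Z (mul_one α) X)
    D.unit_mem (fun _ h => D.dual_mem_one h) (fun _ _ h h' => D.mem_tensor_one h h')
    (fun hY hY' f => by rw [part_Z2, part_Z2, mix_natural])
    (fun {Y Y'} hY hY' hYY => by
      rw [part_Z2, part_Z2, part_Z2]
      have m := mix_mix Z (mul_one α) (mul_one α) (mul_one α) X hY hY' hYY
      rw [reassoc_of% m]
      monoidal)
    (by rw [part_Z2, mix_unit])

theorem free_braid (α : G) (X Y : C) (hY : D.deg 1 Y) :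
    ((free Z α X).braid Y hY).hom = mix Z (mul_one α) X Y hY :=
  part_Z2 Z (mul_one α) X Y hY

/-- A family of morphisms `A ⊗ W ⟶ W ⊗ B`, for `W ∈ C_β`, compatible with half-braidings. -/
structure Intertwiner (A B : GCenter D) (β : G) where
  map (W : C) (hW : D.deg β W) : A.obj ⊗ W ⟶ W ⊗ B.obj
  natural {W W' : C} (hW : D.deg β W) (hW' : D.deg β W') (f : W ⟶ W') :
    A.obj ◁ f ≫ map W' hW' = map W hW ≫ f ▷ B.obj
  left {Y W : C} (hY : D.deg 1 Y) (hW : D.deg β W) (hYW : D.deg β (Y ⊗ W)) :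
    (A.braid Y hY).hom ▷ W ≫ (α_ _ _ _).hom ≫ Y ◁ map W hW =
      (α_ _ _ _).hom ≫ map (Y ⊗ W) hYW ≫ (α_ _ _ _).hom
  right {W Y : C} (hW : D.deg β W) (hY : D.deg 1 Y) (hWY : D.deg β (W ⊗ Y)) :
    map W hW ▷ Y ≫ (α_ _ _ _).hom ≫ W ◁ (B.braid Y hY).hom =
      (α_ _ _ _).hom ≫ map (W ⊗ Y) hWY ≫ (α_ _ _ _).hom

/-- The morphism `(ev_V ⊗ B) (V^* ⊗ m) : V^* ⊗ A ⊗ V ⟶ B` for `m : A ⊗ V ⟶ V ⊗ B`. -/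
def absorb {A B V : C} (m : A ⊗ V ⟶ V ⊗ B) : dual V ⊗ (A ⊗ V) ⟶ B :=
  dual V ◁ m ≫ (α_ _ _ _).inv ≫ ev V ▷ _ ≫ (λ_ _).hom

section Intertwiner

variable {A B : GCenter D} {β : G} (m : Intertwiner A B β)

theorem push_absorb (hp : IsPure C) (W U : C) (hW : D.deg β W)
    (hU : D.deg β U) (hWU : D.deg 1 (W ⊗ dual U)) :
    push A W U hWU ≫ W ◁ absorb (m.map U hU) = scal (dimL U) (m.map W hW) := by
  have hm : D.deg β ((W ⊗ dual U) ⊗ U) := D.mem_one_tensor hWU hU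
  have l := m.left hWU hU hm
  let f : (W ⊗ dual U) ⊗ U ⟶ W := (α_ _ _ _).hom ≫ W ◁ ev U ≫ (ρ_ _).hom
  have n := m.natural hm hW f
  calc _ = 𝟙 _ ⊗≫ (A.obj ⊗ W) ◁ coevt U ⊗≫
        ((A.braid (W ⊗ dual U) hWU).hom ▷ U ≫ (α_ _ _ _).hom ≫
        (W ⊗ dual U) ◁ m.map U hU) ⊗≫ W ◁ (ev U ▷ B.obj) ⊗≫ 𝟙 _ := by
        unfold push absorb; monoidal
    _ = 𝟙 _ ⊗≫ (A.obj ⊗ W) ◁ coevt U ⊗≫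
        (m.map ((W ⊗ dual U) ⊗ U) hm ≫ f ▷ _) ⊗≫ 𝟙 _ := by
        rw [l]; simp only [f]; monoidal
    _ = 𝟙 _ ⊗≫ A.obj ◁ (W ◁ (coevt U ≫ ev U)) ⊗≫ m.map W hW := by
        rw [← n]; simp only [f]; monoidal
    _ = 𝟙 _ ⊗≫ A.obj ◁ (W ◁ (dimL U ▷ 𝟙_ C)) ⊗≫ m.map W hW := by
        simp only [dimL]; monoidal
    _ = _ := by
        rw [whiskerRight_eq_scal]
        simp only [hp.whiskerLeft_scal, scal_monoidalComp, monoidalComp_scal]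
        congr 1
        monoidal

theorem pass_absorb (hp : IsPure C) (V Y U : C) (hV : D.deg β V) (hU : D.deg β U)
    (hY : D.deg 1 Y) (hVU : D.deg 1 ((V ⊗ Y) ⊗ dual U)) :
    pass A V Y U hVU ≫ Y ◁ absorb (m.map U hU) =
      scal (dimL U) (absorb (m.map V hV) ▷ Y ≫ (B.braid Y hY).hom) := by
  have hVY := D.mem_tensor_one hV hY
  have p := push_absorb m hp (V ⊗ Y) U hVY hU hVU
  have r := m.right hV hY hVY
  calc _ = 𝟙 _ ⊗≫ dual V ◁ push A (V ⊗ Y) U hVU ⊗≫ (ev V ▷ (Y ⊗ (dual U ⊗ (A.obj ⊗ U))) ≫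
        𝟙_ C ◁ (Y ◁ absorb (m.map U hU))) ⊗≫ 𝟙 _ := by unfold pass; monoidal
    _ = 𝟙 _ ⊗≫ dual V ◁ (push A (V ⊗ Y) U hVU ≫ (V ⊗ Y) ◁ absorb (m.map U hU)) ⊗≫
        ev V ▷ (Y ⊗ B.obj) ⊗≫ 𝟙 _ := by
        rw [← whisker_exchange]; monoidal
    _ = scal (dimL U) (𝟙 _ ⊗≫ dual V ◁ m.map (V ⊗ Y) hVY ⊗≫
        ev V ▷ (Y ⊗ B.obj) ⊗≫ 𝟙 _) := by
        rw [p]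
        simp only [hp.whiskerLeft_scal, scal_monoidalComp, monoidalComp_scal]
    _ = scal (dimL U) (𝟙 _ ⊗≫ dual V ◁ ((α_ _ _ _).hom ≫ m.map (V ⊗ Y) hVY ≫ (α_ _ _ _).hom)
        ⊗≫ ev V ▷ (Y ⊗ B.obj) ⊗≫ 𝟙 _) := by
        congr 1; monoidal
    _ = scal (dimL U) (𝟙 _ ⊗≫ (dual V ◁ m.map V hV) ▷ Y ⊗≫
        ((dual V ⊗ V) ◁ (B.braid Y hY).hom ≫ ev V ▷ (Y ⊗ B.obj)) ⊗≫ 𝟙 _) := by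
        rw [← r]; congr 1; monoidal
    _ = _ := by
        rw [whisker_exchange]; congr 1; unfold absorb; monoidal

theorem pass₀_absorb (hp : IsPure C) (V U : C) (hV : D.deg β V) (hU : D.deg β U)
    (hVU : D.deg 1 (V ⊗ dual U)) :
    pass₀ A V U hVU ≫ absorb (m.map U hU) = scal (dimL U) (absorb (m.map V hV)) := by
  have hVU' : D.deg 1 ((V ⊗ 𝟙_ C) ⊗ dual U) :=
    D.mem_tensor_dual (D.mem_tensor_one hV D.unit_mem) hU
  have p := pass_absorb m hp V (𝟙_ C) U hV hU D.unit_mem hVU'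
  rw [pass_unit A V U hVU' hVU,
    B.braid_unit D.unit_mem (D.mem_tensor_one D.unit_mem D.unit_mem)] at p
  calc _ = (ρ_ _).inv ≫ (((ρ_ _).hom ≫ pass₀ A V U hVU ≫ (λ_ _).inv) ≫
        𝟙_ C ◁ absorb (m.map U hU)) ≫ (λ_ _).hom := by monoidal
    _ = _ := by
      rw [p]
      simp only [scal_comp, comp_scal]
      congr 1
      monoidal

variable (S : Splittings D)

/-- The morphism `d_V⁻¹ (ev_V ⊗ B) (V^* ⊗ m_V) q^V : φ_V(A) ⟶ B`. -/
def Intertwiner.toHom (hp : IsPure C) (V : InvObj D β) : (phi S hp V).obj A ⟶ B where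
  hom := (S β V A).q ≫ scal V.invDim (absorb (m.map V.obj V.mem))
  comm Y hY := by
    have p := pass_absorb m hp V.obj Y V.obj V.mem V.mem hY (mem_mid V.mem hY V.mem)
    have c := pass_pi hp V V A Y hY
    have e : ((S β V A).q ≫ scal V.invDim (absorb (m.map V.obj V.mem))) ▷ Y ≫
        (B.braid Y hY).hom = scal V.invDim (mid S V V A Y hY) ≫
        Y ◁ ((S β V A).q ≫ scal V.invDim (absorb (m.map V.obj V.mem))) := by
      calc _ = scal V.invDim ((S β V A).q ▷ Y ≫ absorb (m.map V.obj V.mem) ▷ Y ≫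
            (B.braid Y hY).hom) := by
            rw [comp_scal, scal_whiskerRight, scal_comp, comp_whiskerRight, Category.assoc]
        _ = scal V.invDim (scal V.invDim ((S β V A).q ▷ Y ≫
            pass A V.obj Y V.obj (mem_mid V.mem hY V.mem) ≫
            Y ◁ absorb (m.map V.obj V.mem))) := by
            rw [p, comp_scal, scal_scal V.invDim (dimL _), V.invDim_dim, scal_one]
        _ = scal V.invDim (scal V.invDim ((S β V A).q ▷ Y ≫
            (pass A V.obj Y V.obj (mem_mid V.mem hY V.mem) ≫ Y ◁ piV V A) ≫
            Y ◁ absorb (m.map V.obj V.mem))) := by rw [c]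
        _ = _ := by
            rw [comp_scal, hp.whiskerLeft_scal, comp_scal, scal_comp]
            unfold mid
            simp only [Category.assoc, ← MonoidalCategory.whiskerLeft_comp,
              reassoc_of% (S β V A).p_q]
    exact e

theorem Intertwiner.delta_toHom (hp : IsPure C) (U V : InvObj D β) :
    scal V.invDim (delta₀ S V U A) ≫ (S β U A).q ≫ scal U.invDim (absorb (m.map U.obj U.mem)) =
      (S β V A).q ≫ scal V.invDim (absorb (m.map V.obj V.mem)) := by
  have p := pass₀_absorb m hp V.obj U.obj V.mem U.mem (D.mem_tensor_dual V.mem U.mem)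
  have p' := pass₀_absorb m hp U.obj U.obj U.mem U.mem (D.mem_tensor_dual U.mem U.mem)
  have c : piV U A ≫ absorb (m.map U.obj U.mem) = absorb (m.map U.obj U.mem) := by
    rw [piV, scal_comp, p', scal_scal, U.invDim_dim, scal_one]
  calc _ = scal V.invDim (scal U.invDim ((S β V A).q ≫
        pass₀ A V.obj U.obj (D.mem_tensor_dual V.mem U.mem) ≫ ((S β U A).p ≫ (S β U A).q) ≫
        absorb (m.map U.obj U.mem))) := by
        unfold delta₀
        simp only [comp_scal, scal_comp, Category.assoc]
        rw [scal_comm]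
    _ = _ := by
        rw [(S β U A).p_q, c, p, comp_scal, scal_scal U.invDim, U.invDim_dim, scal_one, comp_scal]

theorem Intertwiner.Gam_toHom (hp : IsPure C) (V : InvObj D β) (W : C) (hW : D.deg β W) :
    Gam S V A W hW ≫ W ◁ ((S β V A).q ≫ scal V.invDim (absorb (m.map V.obj V.mem))) =
      m.map W hW := by
  have p := push_absorb m hp W V.obj hW V.mem (D.mem_tensor_dual hW V.mem)
  have p' := pass₀_absorb m hp V.obj V.obj V.mem V.mem (D.mem_tensor_dual V.mem V.mem)
  have c : piV V A ≫ absorb (m.map V.obj V.mem) = absorb (m.map V.obj V.mem) := by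
    rw [piV, scal_comp, p', scal_scal, V.invDim_dim, scal_one]
  calc _ = scal V.invDim (push A W V.obj (D.mem_tensor_dual hW V.mem) ≫
        W ◁ (((S β V A).p ≫ (S β V A).q) ≫ absorb (m.map V.obj V.mem))) := by
        unfold Gam
        simp only [comp_scal, hp.whiskerLeft_scal, Category.assoc,
          MonoidalCategory.whiskerLeft_comp]
    _ = _ := by
        rw [(S β V A).p_q, c, p, scal_scal, V.invDim_dim, scal_one]

end Intertwiner

/-- The family `(W ⊗ Z_2(β,α)_X) ∂^β_{Z_α(X),W}`. -/
def freeIntertwiner {α β γ : G} (h : α * β = γ) (X : C) :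
    Intertwiner (free Z α X) (free Z γ X) β where
  map W hW := (Z β).part ((Z α).obj X) W hW ≫ W ◁ Z2 Z h X
  natural {W W'} hW hW' f := by
    have e := mix_natural Z h X hW hW' f
    simp only [← part_Z2] at e
    exact e
  left {Y W} hY hW hYW := by
    have e := mix_mix Z (mul_one α) h h X hY hW hYW
    simp only [← part_Z2] at e
    exact e
  right {W Y} hW hY hWY := by
    have e := mix_mix Z h (mul_one γ) h X hW hY hWY
    simp only [← part_Z2] at e
    exact e

/-- The morphism `ω^{V}_X : φ_V(F_α(X)) ⟶ F_γ(X)` in the `G`-center, where `V ∈ E_β` and `γ = αβ`: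
it is the composition of `q^V` with
`a^V_X = d_V⁻¹ (ev_V ⊗ id) (V^* ⊗ (V ⊗ Z_2(β,α)_X) ∂^β_{Z_α(X),V})`. -/
def omegaV (S : Splittings D) (hp : IsPure C) {α β γ : G} (h : α * β = γ) (X : C)
    (V : InvObj D β) : (phi S hp V).obj (free Z α X) ⟶ free Z γ X where
  hom := (S β V (free Z α X)).q ≫ scal V.invDim
    (absorb ((Z β).part ((Z α).obj X) V.obj V.mem ≫ V.obj ◁ Z2 Z h X))
  comm := ((freeIntertwiner Z h X).toHom S hp V).comm

variable {S : Splittings D} {hp : IsPure C}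

theorem existsUnique_lift_left {K : Type*} [Category K] {I : Type*} {E B : K} (F : I → K)
    (leg : ∀ V, E ⟶ F V)
    (d : ∀ V U, F V ⟶ F U) (hd : ∀ V U, leg V ≫ d V U = leg U)
    (g : ∀ V, F V ⟶ B) (hg : ∀ V U, d V U ≫ g U = g V) (hI : Nonempty I) :
    ∃! t : E ⟶ B, ∀ V, leg V ≫ g V = t := by
  obtain ⟨V⟩ := hI
  refine ⟨leg V ≫ g V, fun U => ?_, fun t ht => (ht V).symm⟩
  rw [← hd V U, Category.assoc, hg]

theorem existsUnique_omega (hn : NonSingular D) (L : Crossing S hp) {α β γ : G}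
    (h : α * β = γ) (X : C) :
    ∃! w : (L.functor β).obj (free Z α X) ⟶ free Z γ X,
      ∀ V : InvObj D β, (L.ι V).app (free Z α X) ≫ omegaV Z S hp h X V = w := by
  refine existsUnique_lift_left (fun V : InvObj D β => (phi S hp V).obj (free Z α X))
    (fun V => (L.ι V).app _) (fun V U => (delta S hp U V).app (free Z α X))
    (fun V U => ?_) (fun V => omegaV Z S hp h X V) (fun V U => ?_) (hn.exists_inv β)
  · rw [← L.ι_delta U V]; rfl
  · apply RelCenter.hom_ext
    exact (freeIntertwiner Z h X).delta_toHom S hp U V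

/-- The morphism `ω^{β,α}_X : φ_β(F_α(X)) ⟶ F_γ(X)` in the `G`-center, where `γ = αβ`: the unique
one such that `ω^{β,α}_X = ω^V_X ∘ (ι^β_V)_{F_α(X)}` for all `V ∈ E_β`. -/
def omega (hn : NonSingular D) (L : Crossing S hp) {α β γ : G} (h : α * β = γ) (X : C) :
    (L.functor β).obj (free Z α X) ⟶ free Z γ X :=
  (existsUnique_omega Z hn L h X).choose

theorem ι_omegaV (hn : NonSingular D) (L : Crossing S hp) {α β γ : G} (h : α * β = γ) (X : C)
    (V : InvObj D β) :
    (L.ι V).app (free Z α X) ≫ omegaV Z S hp h X V = omega Z hn L h X :=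
  (existsUnique_omega Z hn L h X).choose_spec.1 V

end Free

end

end GCat

namespace GCat

noncomputable section

section Fusion

variable (k : Type*) [CommRing k] {G : Type w} [Group G] {C : Type u} [Category.{v} C]
  [MonoidalCategory C] [PivotalCategory C] [Preadditive C] [Linear k C] [HasFiniteBiproducts C]

/-- An object is simple if its endomorphism module is free of rank `1` over `k`. -/
def IsSimpleObj (X : C) : Prop := Nonempty (k ≃ₗ[k] (X ⟶ X))

/-- A `G`-graded pivotal category is `G`-fusion (over `k`) if its unit object is simple, it is split
semisimple, i.e. every object is a finite direct sum of simple objects and there are no non-zero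
morphisms between non-isomorphic simple objects, and, for every `α`, the category `C_α` has at least
one and, up to isomorphism, only finitely many simple objects. -/
structure IsGFusion (D : PivotalGrading G C) : Prop where
  unit_simple : IsSimpleObj k (𝟙_ C)
  exists_decomposition (X : C) : ∃ (n : ℕ) (f : Fin n → C),
    (∀ m, IsSimpleObj k (f m)) ∧ Nonempty (X ≅ ⨁ f)
  hom_eq_zero (i j : C) : IsSimpleObj k i → IsSimpleObj k j → ¬ Nonempty (i ≅ j) →
    ∀ f : i ⟶ j, f = 0
  exists_simple (α : G) : ∃ i : C, D.deg α i ∧ IsSimpleObj k i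
  finite_simple (α : G) : ∃ s : Finset C, ∀ i : C, D.deg α i → IsSimpleObj k i →
    ∃ j ∈ s, Nonempty (i ≅ j)

/-- A `G`-representative set of simple objects: its elements are simple and homogeneous, and every
simple object is isomorphic to a unique element of it. -/
structure IsGRepresentative (D : PivotalGrading G C) (I : Set C) : Prop where
  simple : ∀ i ∈ I, IsSimpleObj k i
  homogeneous : ∀ i ∈ I, ∃ α : G, D.deg α i
  existsUnique : ∀ j : C, IsSimpleObj k j → ∃! i : C, i ∈ I ∧ Nonempty (j ≅ i)

/-- The set `I_α` of elements of `I` belonging to `C_α`. -/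
def Component (D : PivotalGrading G C) (I : Set C) (α : G) : Type u :=
  {i : C // i ∈ I ∧ D.deg α i}

variable {k}

theorem finite_component {D : PivotalGrading G C} {I : Set C} (hF : IsGFusion k D)
    (hI : IsGRepresentative k D I) (α : G) : Finite (Component D I α) := by
  obtain ⟨s, hs⟩ := hF.finite_simple α
  choose f hf hf' using fun i : Component D I α => hs i.1 i.2.2 (hI.simple _ i.2.1)
  refine Finite.of_injective (fun i => (⟨f i, hf i⟩ : s)) fun i j hij => ?_
  have e : f i = f j := congrArg Subtype.val hij
  obtain ⟨a⟩ := hf' i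
  obtain ⟨b⟩ := hf' j
  obtain ⟨l, -, hl⟩ := hI.existsUnique i.1 (hI.simple _ i.2.1)
  have h1 : i.1 = l := hl i.1 ⟨i.2.1, ⟨Iso.refl _⟩⟩
  have h2 : j.1 = l := hl j.1 ⟨j.2.1, ⟨a ≪≫ eqToIso e ≪≫ b.symm⟩⟩
  exact Subtype.ext (h1.trans h2.symm)

/-- The finite set `I_α`, as a `Fintype`. -/
@[reducible]
def componentFintype {D : PivotalGrading G C} {I : Set C} (hF : IsGFusion k D)
    (hI : IsGRepresentative k D I) (α : G) : Fintype (Component D I α) :=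
  have := finite_component hF hI α
  Fintype.ofFinite _

/-- Morphisms `ρ_i : F_i ⟶ T` and `π_i : T ⟶ F_i` which exhibit `T` as the direct sum of the finite
family `F`. -/
structure IsDirectSum {J : Type*} [Fintype J] {F : J → C} {T : C} (ρ : ∀ i, F i ⟶ T)
    (π : ∀ i, T ⟶ F i) : Prop where
  ρ_π (i : J) : ρ i ≫ π i = 𝟙 (F i)
  ρ_π_ne (i j : J) : i ≠ j → ρ i ≫ π j = 0
  sum : ∑ i, π i ≫ ρ i = 𝟙 T

/-- An `I_α`-partition of `T`: a decomposition of `T` as a direct sum of a finite family of objects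
belonging to `I_α`. -/
structure Partition (D : PivotalGrading G C) (I : Set C) (α : G) (T : C) where
  n : ℕ
  idx : Fin n → Component D I α
  p (l : Fin n) : T ⟶ (idx l).1
  q (l : Fin n) : (idx l).1 ⟶ T
  isDirectSum : IsDirectSum q p

/-- For `p : i ⊗ Y ⟶ j` and `q : j ⟶ i ⊗ Y`, the morphism
`i^* ⊗ X ⊗ i ⊗ Y ⟶ Y ⊗ j^* ⊗ X ⊗ j` given by
`((ev_i ⊗ Y ⊗ j^*) (i^* ⊗ q ⊗ j^*) (i^* ⊗ coev_j)) ⊗ X ⊗ p`. -/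
def braidTerm (X : C) {i j Y : C} (p : i ⊗ Y ⟶ j) (q : j ⟶ i ⊗ Y) :
    (dual i ⊗ (X ⊗ i)) ⊗ Y ⟶ Y ⊗ (dual j ⊗ (X ⊗ j)) :=
  𝟙 _ ⊗≫ (dual i ◁ coev j ⊗≫ dual i ◁ (q ▷ dual j) ⊗≫ ev i ▷ (Y ⊗ dual j)) ▷ (X ⊗ (i ⊗ Y)) ⊗≫
    (Y ⊗ dual j) ◁ (X ◁ p) ⊗≫ 𝟙 _

end Fusion

end

end GCat

open GCat

/-!
For `V ∈ E_β` the morphism `ω^V_X` is, up to `q^V` and `d_V⁻¹`, obtained from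
`∂ : Z_α(X) ⊗ V ⟶ V ⊗ Z_{αβ}(X)` by evaluating `V` against `V^*`. Bending the strand `V^*` of
`∂^α_{X,W ⊗ V^*}` gives a dinatural family in `W ∈ C_{αβ}`, hence a morphism
`Z_{αβ}(X) ⟶ V^* ⊗ Z_α(X) ⊗ V`. One composite of the two is `d_V π^V` and the other one is a circle,
i.e. the scalar `d_V`; so `ω^V_X`, and with it `ω_X`, is invertible. The formula for `τ` expresses
that `∂` commutes with half-braidings, which turns the defining property of `τ` into
`(Y ⊗ ω) τ = ∂`.

In the fusion case every `Y ∈ C_δ` is a retract of a finite direct sum of members of `I_δ`, so a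
natural family `X ⊗ Y ⟶ Y ⊗ B` on `C_δ` is the same as one on `I_δ`; there naturality is automatic
because the morphisms between members are scalars. Hence `Z_δ(X)` has the universal property of
`⨁ i^* ⊗ X ⊗ i`.
-/

namespace GCat

noncomputable section

section Transposition

variable {C : Type u} [Category.{v} C] [MonoidalCategory C] [PivotalCategory C]

theorem absorb_comp_whiskerLeft {A B E V : C} (m : A ⊗ V ⟶ V ⊗ B) (r : B ⟶ E) :
    absorb (m ≫ V ◁ r) = absorb m ≫ r := by
  let transpose (B : C) := tensorLeftHomEquiv (A ⊗ V) V (dual V) B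
  refine (transpose E).symm_apply_eq.2 ?_
  calc m ≫ V ◁ r = transpose B ((transpose B).symm m) ≫ V ◁ r := by
        rw [Equiv.apply_symm_apply]
    _ = transpose E (absorb m ≫ r) := (tensorLeftHomEquiv_naturality _ _).symm

theorem absorb_coev {X Y B : C} (d : dual Y ⊗ (X ⊗ Y) ⟶ B) :
    absorb ((λ_ _).inv ≫ coev Y ▷ (X ⊗ Y) ≫ (α_ _ _ _).hom ≫ Y ◁ d) = d :=
  (tensorLeftHomEquiv (X ⊗ Y) Y (dual Y) B).symm_apply_apply d

/-- The morphism `(s ⊗ U) (A ⊗ W ⊗ coevt_U)`, which bends the strand `U^*` of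
`s : A ⊗ W ⊗ U^* ⟶ W ⊗ U^* ⊗ B`. Both `push` and the family defining `expand` are of this form. -/
def bend {A B W U : C} (s : A ⊗ (W ⊗ dual U) ⟶ (W ⊗ dual U) ⊗ B) :
    A ⊗ W ⟶ W ⊗ (dual U ⊗ (B ⊗ U)) :=
  𝟙 _ ⊗≫ (A ⊗ W) ◁ coevt U ⊗≫ s ▷ U ⊗≫ 𝟙 _

theorem bend_natural {A B W W' U : C} {s : A ⊗ (W ⊗ dual U) ⟶ (W ⊗ dual U) ⊗ B}
    {s' : A ⊗ (W' ⊗ dual U) ⟶ (W' ⊗ dual U) ⊗ B} {f : W ⟶ W'}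
    (n : A ◁ (f ▷ dual U) ≫ s' = s ≫ (f ▷ dual U) ▷ B) :
    A ◁ f ≫ bend s' = bend s ≫ f ▷ (dual U ⊗ (B ⊗ U)) := by
  unfold bend
  calc _ = 𝟙 _ ⊗≫ ((A ◁ f) ▷ 𝟙_ C ≫ (A ⊗ W') ◁ coevt U) ⊗≫ s' ▷ U ⊗≫ 𝟙 _ := by monoidal
    _ = 𝟙 _ ⊗≫ (A ⊗ W) ◁ coevt U ⊗≫ (A ◁ (f ▷ dual U) ≫ s') ▷ U ⊗≫ 𝟙 _ := by
      rw [← whisker_exchange]; monoidal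
    _ = _ := by rw [n]; monoidal

theorem bend_comp_absorb (hp : IsPure C) {A B E W U : C}
    {s : A ⊗ (W ⊗ dual U) ⟶ (W ⊗ dual U) ⊗ B} {m : B ⊗ U ⟶ U ⊗ E}
    {t : A ⊗ ((W ⊗ dual U) ⊗ U) ⟶ ((W ⊗ dual U) ⊗ U) ⊗ E} {t₀ : A ⊗ W ⟶ W ⊗ E}
    (h : s ▷ U ≫ (α_ _ _ _).hom ≫ (W ⊗ dual U) ◁ m = (α_ _ _ _).hom ≫ t ≫ (α_ _ _ _).hom)
    (n : A ◁ ((α_ _ _ _).hom ≫ W ◁ ev U ≫ (ρ_ W).hom) ≫ t₀ =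
      t ≫ ((α_ _ _ _).hom ≫ W ◁ ev U ≫ (ρ_ W).hom) ▷ E) :
    bend s ≫ W ◁ absorb m = scal (dimL U) t₀ := by
  calc _ = 𝟙 _ ⊗≫ (A ⊗ W) ◁ coevt U ⊗≫ (s ▷ U ≫ (α_ _ _ _).hom ≫ (W ⊗ dual U) ◁ m) ⊗≫
        W ◁ (ev U ▷ E) ⊗≫ 𝟙 _ := by unfold bend absorb; monoidal
    _ = 𝟙 _ ⊗≫ (A ⊗ W) ◁ coevt U ⊗≫
        (t ≫ ((α_ _ _ _).hom ≫ W ◁ ev U ≫ (ρ_ W).hom) ▷ E) ⊗≫ 𝟙 _ := by rw [h]; monoidal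
    _ = 𝟙 _ ⊗≫ A ◁ (W ◁ (coevt U ≫ ev U)) ⊗≫ t₀ := by rw [← n]; monoidal
    _ = 𝟙 _ ⊗≫ A ◁ (W ◁ (dimL U ▷ 𝟙_ C)) ⊗≫ t₀ := by simp only [dimL]; monoidal
    _ = scal (dimL U) (𝟙 _ ⊗≫ t₀) := by
      rw [whiskerRight_eq_scal]
      simp only [hp.whiskerLeft_scal, scal_monoidalComp, monoidalComp_scal]
      congr 1
      monoidal
    _ = _ := by congr 1; monoidal

/-- The morphism `(ev_W ⊗ Y ⊗ B) (W^* ⊗ m)`, which evaluates the first tensor factor of the target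
of `m` against its dual. -/
def absorbFst {X W Y B : C} (m : X ⊗ (W ⊗ Y) ⟶ (W ⊗ Y) ⊗ B) :
    (dual W ⊗ (X ⊗ W)) ⊗ Y ⟶ Y ⊗ B :=
  𝟙 _ ⊗≫ dual W ◁ m ⊗≫ ev W ▷ (Y ⊗ B) ⊗≫ 𝟙 _

theorem absorb_whiskerRight_comp {X W Y A B : C} {a : X ⊗ W ⟶ W ⊗ A} {b : A ⊗ Y ⟶ Y ⊗ B}
    {m : X ⊗ (W ⊗ Y) ⟶ (W ⊗ Y) ⊗ B}
    (h : a ▷ Y ≫ (α_ _ _ _).hom ≫ W ◁ b = (α_ _ _ _).hom ≫ m ≫ (α_ _ _ _).hom) :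
    absorb a ▷ Y ≫ b = absorbFst m := by
  calc _ = 𝟙 _ ⊗≫ dual W ◁ (a ▷ Y) ⊗≫ (ev W ▷ (A ⊗ Y) ≫ 𝟙_ C ◁ b) ⊗≫ 𝟙 _ := by
        unfold absorb; monoidal
    _ = 𝟙 _ ⊗≫ dual W ◁ (a ▷ Y ≫ (α_ _ _ _).hom ≫ W ◁ b) ⊗≫ ev W ▷ (Y ⊗ B) ⊗≫ 𝟙 _ := by
        rw [← whisker_exchange]; monoidal
    _ = _ := by rw [h]; unfold absorbFst; monoidal

theorem absorbFst_sum [Preadditive C] [MonoidalPreadditive C] {J : Type*} [Fintype J]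
    {X W Y B : C} (m : J → (X ⊗ (W ⊗ Y) ⟶ (W ⊗ Y) ⊗ B)) :
    absorbFst (∑ l, m l) = ∑ l, absorbFst (m l) := by
  simp only [absorbFst, monoidalComp, whiskerLeft_sum, Preadditive.sum_comp, Preadditive.comp_sum]

theorem braidTerm_whiskerLeft {X i j Y B : C} (p : i ⊗ Y ⟶ j) (q : j ⟶ i ⊗ Y)
    (d : dual j ⊗ (X ⊗ j) ⟶ B) :
    braidTerm X p q ≫ Y ◁ d = absorbFst (X ◁ p ≫
      ((λ_ _).inv ≫ coev j ▷ (X ⊗ j) ≫ (α_ _ _ _).hom ≫ j ◁ d) ≫ q ▷ B) := by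
  symm
  calc _ = 𝟙 _ ⊗≫ dual i ◁ (𝟙_ C ◁ (X ◁ p) ≫ coev j ▷ (X ⊗ j)) ⊗≫
        dual i ◁ (j ◁ d ≫ q ▷ B) ⊗≫ ev i ▷ (Y ⊗ B) ⊗≫ 𝟙 _ := by
        unfold absorbFst; monoidal
    _ = 𝟙 _ ⊗≫ dual i ◁ (coev j ▷ (X ⊗ (i ⊗ Y))) ⊗≫
        dual i ◁ ((j ⊗ dual j) ◁ (X ◁ p) ≫ q ▷ dual j ▷ (X ⊗ j)) ⊗≫
        ((dual i ⊗ i) ◁ (Y ◁ d) ≫ ev i ▷ (Y ⊗ B)) ⊗≫ 𝟙 _ := by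
        rw [whisker_exchange, whisker_exchange]; monoidal
    _ = 𝟙 _ ⊗≫ dual i ◁ (coev j ▷ (X ⊗ (i ⊗ Y))) ⊗≫ dual i ◁ (q ▷ dual j ▷ (X ⊗ (i ⊗ Y))) ⊗≫
        ((dual i ⊗ i) ◁ ((Y ⊗ dual j) ◁ (X ◁ p)) ≫ ev i ▷ ((Y ⊗ dual j) ⊗ (X ⊗ j))) ⊗≫
        Y ◁ d ⊗≫ 𝟙 _ := by
        rw [whisker_exchange, whisker_exchange]; monoidal
    _ = _ := by
        rw [whisker_exchange]; unfold braidTerm; monoidal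

end Transposition

namespace Centralizer

variable {C : Type u} [Category.{v} C] [MonoidalCategory C] [PivotalCategory C]
  {P : ObjectProperty C} (Z : Centralizer P)

theorem absorb_part (X Y : C) (hY : P Y) : absorb (Z.part X Y hY) = Z.rho X Y hY :=
  (Z.rho_eq X Y hY).symm

theorem rho_comp {X B : C} (Y : C) (hY : P Y) (r : Z.obj X ⟶ B) :
    Z.rho X Y hY ≫ r = absorb (Z.part X Y hY ≫ Y ◁ r) := by
  rw [absorb_comp_whiskerLeft, absorb_part]

theorem rho_comp_eq_iff {X B : C} (Y : C) (hY : P Y) (r : Z.obj X ⟶ B)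
    (d : dual Y ⊗ (X ⊗ Y) ⟶ B) :
    Z.rho X Y hY ≫ r = d ↔ Z.part X Y hY ≫ Y ◁ r =
      (λ_ _).inv ≫ coev Y ▷ (X ⊗ Y) ≫ (α_ _ _ _).hom ≫ Y ◁ d := by
  constructor
  · rintro rfl
    simp only [part, Category.assoc, MonoidalCategory.whiskerLeft_comp]
  · intro h
    rw [rho_comp, h, absorb_coev]

theorem part_comp_natural (X : C) {B W W' : C} (hW : P W) (hW' : P W') (f : W ⟶ W')
    (r : Z.obj X ⟶ B) :
    X ◁ f ≫ Z.part X W' hW' ≫ W' ◁ r = (Z.part X W hW ≫ W ◁ r) ≫ f ▷ B := by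
  rw [reassoc_of% Z.part_natural X hW hW' f, Category.assoc, whisker_exchange]

theorem part_ext {X B : C} {r r' : Z.obj X ⟶ B}
    (h : ∀ (W : C) (hW : P W), Z.part X W hW ≫ W ◁ r = Z.part X W hW ≫ W ◁ r') :
    r = r' :=
  (Z.existsUnique X B (fun W hW => Z.part X W hW ≫ W ◁ r')
    (fun _ _ hW hW' f => Z.part_comp_natural X hW hW' f r')).unique h (fun _ _ => rfl)

theorem part_eq_sum [Preadditive C] [MonoidalPreadditive C] (X : C) {Y : C} (hY : P Y)
    {J : Type*} [Fintype J] {F : J → C} (hF : ∀ l, P (F l)) {p : ∀ l, Y ⟶ F l}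
    {q : ∀ l, F l ⟶ Y} (h : ∑ l, p l ≫ q l = 𝟙 Y) :
    Z.part X Y hY = ∑ l, X ◁ p l ≫ Z.part X (F l) (hF l) ≫ q l ▷ Z.obj X := by
  calc _ = X ◁ (∑ l, p l ≫ q l) ≫ Z.part X Y hY := by
        rw [h, MonoidalCategory.whiskerLeft_id, Category.id_comp]
    _ = ∑ l, X ◁ p l ≫ X ◁ q l ≫ Z.part X Y hY := by
        simp only [whiskerLeft_sum, Preadditive.sum_comp, MonoidalCategory.whiskerLeft_comp,
          Category.assoc]
    _ = _ := by simp only [Z.part_natural X (hF _) hY]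

end Centralizer

theorem RelCenter.eq_comp_whiskerLeft_inv {C : Type u} [Category.{v} C] [MonoidalCategory C]
    {P : ObjectProperty C} {A B : RelCenter P} (w : A ⟶ B) [IsIso w] {T Y : C} {t : T ⟶ Y ⊗ A.obj}
    {m : T ⟶ Y ⊗ B.obj} (h : t ≫ Y ◁ w.hom = m) : t = m ≫ Y ◁ (inv w).hom := by
  rw [← h, Category.assoc, ← MonoidalCategory.whiskerLeft_comp, ← RelCenter.comp_hom,
    IsIso.hom_inv_id, RelCenter.id_hom, MonoidalCategory.whiskerLeft_id, Category.comp_id]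

section Crossing

variable {G : Type w} [Group G] {C : Type u} [Category.{v} C] [MonoidalCategory C]
  [PivotalCategory C] [Preadditive C] [HasFiniteBiproducts C] {D : PivotalGrading G C}

theorem Splitting.isIso_q_comp {K : Type*} [Category K] {T B : K} {e : T ⟶ T} (s : Splitting e)
    {a : T ⟶ B} {b : B ⟶ T} (h : a ≫ b = e) (h' : b ≫ a = 𝟙 B) : IsIso (s.q ≫ a) := by
  refine ⟨b ≫ s.p, ?_, ?_⟩
  · rw [Category.assoc, reassoc_of% h, s.q_e_p]
  · rw [Category.assoc, reassoc_of% s.p_q, ← h, Category.assoc, h', Category.comp_id, h']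

theorem pass₀_eq_absorb (A : GCenter D) (V U : C) (h : D.deg 1 (V ⊗ dual U)) :
    pass₀ A V U h = absorb (push A V U h) := by
  unfold pass₀ absorb; monoidal

namespace Intertwiner

variable {A B : GCenter D} {β : G} (m : Intertwiner A B β) (S : Splittings D) (hp : IsPure C)

theorem isIso_toHom (V : InvObj D β) {e : B.obj ⟶ dual V.obj ⊗ (A.obj ⊗ V.obj)}
    (h : m.map V.obj V.mem ≫ V.obj ◁ e =
      push A V.obj V.obj (D.mem_tensor_dual V.mem V.mem))
    (h' : e ≫ absorb (m.map V.obj V.mem) = scal (dimL V.obj) (𝟙 B.obj)) :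
    IsIso (m.toHom S hp V) := by
  have absorb_e : scal V.invDim (absorb (m.map V.obj V.mem)) ≫ e = piV V A := by
    rw [piV, pass₀_eq_absorb, ← h, absorb_comp_whiskerLeft, scal_comp]
  have e_absorb : e ≫ scal V.invDim (absorb (m.map V.obj V.mem)) = 𝟙 B.obj := by
    rw [comp_scal, h', scal_scal, V.invDim_dim, scal_one]
  exact RelCenter.isIso_of_hom _ ((S β V A).isIso_q_comp absorb_e e_absorb)

theorem tau_comp_toHom (hn : NonSingular D) {S : Splittings D} {hp : IsPure C}
    (L : Crossing S hp) (V : InvObj D β) (Y : C) (hY : D.deg β Y) :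
    tau hn L A Y hY ≫ Y ◁ ((L.ι V).app A ≫ m.toHom S hp V).hom = m.map Y hY := by
  rw [RelCenter.comp_hom, MonoidalCategory.whiskerLeft_comp, reassoc_of% tau_ι hn L A Y hY V]
  exact m.Gam_toHom S hp V Y hY

end Intertwiner

end Crossing

section FreeObjects

variable {G : Type w} [Group G] {C : Type u} [Category.{v} C] [MonoidalCategory C]
  [PivotalCategory C] [Preadditive C] [HasFiniteBiproducts C] {D : PivotalGrading G C}

theorem PivotalGrading.mem_tensor_dual_eq (D : PivotalGrading G C) {α β γ : G} (h : α * β = γ)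
    {W V : C} (hW : D.deg γ W) (hV : D.deg β V) : D.deg α (W ⊗ dual V) :=
  D.mem_cast (D.tensor_mem hW (D.dual_mem hV)) (by rw [← h, mul_inv_cancel_right])

variable (Z : ∀ α : G, Centralizer (D.deg α)) {α β γ : G} (h : α * β = γ) (X : C)

theorem existsUnique_expand (V : C) (hV : D.deg β V) :
    ∃! r : (Z γ).obj X ⟶ dual V ⊗ ((Z α).obj X ⊗ V), ∀ (W : C) (hW : D.deg γ W),
      (Z γ).part X W hW ≫ W ◁ r =
        bend ((Z α).part X (W ⊗ dual V) (D.mem_tensor_dual_eq h hW hV)) :=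
  (Z γ).existsUnique X _ _ fun _ _ _ _ f => bend_natural ((Z α).part_natural X _ _ (f ▷ dual V))

/-- The morphism `Z_γ(X) ⟶ V^* ⊗ Z_α(X) ⊗ V`, for `γ = αβ` and `V ∈ C_β`, determined by bending the
strand `V^*` of `∂^α_{X,W ⊗ V^*}`. It is inverse, up to the scalar `d_V` and the idempotent `π^V`,
to the morphism which defines `ω^{β,α}_X`. -/
def expand (V : C) (hV : D.deg β V) : (Z γ).obj X ⟶ dual V ⊗ ((Z α).obj X ⊗ V) :=
  (existsUnique_expand Z h X V hV).choose

theorem part_expand (V : C) (hV : D.deg β V) (W : C) (hW : D.deg γ W) :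
    (Z γ).part X W hW ≫ W ◁ expand Z h X V hV =
      bend ((Z α).part X (W ⊗ dual V) (D.mem_tensor_dual_eq h hW hV)) :=
  (existsUnique_expand Z h X V hV).choose_spec.1 W hW

theorem expand_absorb (hp : IsPure C) (V : C) (hV : D.deg β V) :
    expand Z h X V hV ≫ absorb (mix Z h X V hV) = scal (dimL V) (𝟙 _) := by
  refine (Z γ).part_ext fun W hW => ?_
  have hWV := D.mem_tensor_dual_eq h hW hV
  calc _ = bend ((Z α).part X (W ⊗ dual V) hWV) ≫ W ◁ absorb (mix Z h X V hV) := by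
        rw [MonoidalCategory.whiskerLeft_comp, reassoc_of% part_expand Z h X V hV W hW]
    _ = scal (dimL V) ((Z γ).part X W hW) :=
        bend_comp_absorb hp (mix_spec Z h X V hV (W ⊗ dual V) hWV)
          ((Z γ).part_natural X (D.mem_tensor_eq h hWV hV) hW _)
    _ = _ := by
        rw [hp.whiskerLeft_scal, comp_scal, MonoidalCategory.whiskerLeft_id, Category.comp_id]

theorem push_free (W U : C) (hWU : D.deg 1 (W ⊗ dual U)) :
    push (free Z α X) W U hWU = bend (mix Z (mul_one α) X (W ⊗ dual U) hWU) :=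
  congrArg bend (free_braid Z α X _ hWU)

theorem mix_expand (W U : C) (hW : D.deg β W) (hU : D.deg β U) :
    mix Z h X W hW ≫ W ◁ expand Z h X U hU =
      push (free Z α X) W U (D.mem_tensor_dual hW hU) := by
  rw [push_free]
  refine (Z α).param_ext fun T hT => ?_
  have hTW := D.mem_tensor_eq h hT hW
  have hWU := D.mem_tensor_dual hW hU
  have hTWU := D.mem_tensor_eq (mul_one α) hT hWU
  have assoc := (Z α).part_natural X (D.mem_tensor_dual_eq h hTW hU) hTWU (α_ T W (dual U)).hom
  calc _ = ((Z α).part X T hT ▷ W ≫ (α_ _ _ _).hom ≫ T ◁ mix Z h X W hW) ≫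
        T ◁ (W ◁ expand Z h X U hU) := by monoidal
    _ = (α_ _ _ _).hom ≫ ((Z γ).part X (T ⊗ W) hTW ≫ (T ⊗ W) ◁ expand Z h X U hU) ≫
        (α_ _ _ _).hom := by rw [mix_spec]; monoidal
    _ = 𝟙 _ ⊗≫ (X ⊗ (T ⊗ W)) ◁ coevt U ⊗≫
        ((Z α).part X ((T ⊗ W) ⊗ dual U) (D.mem_tensor_dual_eq h hTW hU) ≫
          (α_ T W (dual U)).hom ▷ _) ▷ U ⊗≫ 𝟙 _ := by rw [part_expand]; unfold bend; monoidal
    _ = 𝟙 _ ⊗≫ ((X ⊗ T) ⊗ W) ◁ coevt U ⊗≫ ((α_ _ _ _).hom ≫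
        (Z α).part X (T ⊗ (W ⊗ dual U)) hTWU ≫ (α_ _ _ _).hom) ▷ U ⊗≫ 𝟙 _ := by
        rw [← assoc]; monoidal
    _ = 𝟙 _ ⊗≫ (((X ⊗ T) ⊗ W) ◁ coevt U ≫ (Z α).part X T hT ▷ W ▷ (dual U ⊗ U)) ⊗≫
        T ◁ (mix Z (mul_one α) X (W ⊗ dual U) hWU ▷ U) ⊗≫ 𝟙 _ := by
        rw [← mix_spec Z (mul_one α) X (W ⊗ dual U) hWU T hT]; monoidal
    _ = _ := by rw [whisker_exchange]; unfold bend; monoidal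

theorem rho_whiskerRight_mix (Y : C) (hY : D.deg β Y) (W : C) (hW : D.deg α W) :
    (Z α).rho X W hW ▷ Y ≫ mix Z h X Y hY =
      absorbFst ((Z γ).part X (W ⊗ Y) (D.mem_tensor_eq h hW hY)) := by
  rw [← (Z α).absorb_part]
  exact absorb_whiskerRight_comp (mix_spec Z h X Y hY W hW)

theorem part_comp_whiskerLeft_Z2_comp (Y : C) (hY : D.deg β Y) {B : C}
    (r : (Z γ).obj X ⟶ B) :
    (Z β).part ((Z α).obj X) Y hY ≫ Y ◁ (Z2 Z h X ≫ r) = mix Z h X Y hY ≫ Y ◁ r := by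
  rw [MonoidalCategory.whiskerLeft_comp, reassoc_of% part_Z2 Z h X Y hY]

theorem mix_eq_sum_braidTerm [MonoidalPreadditive C] (Y : C) (hY : D.deg β Y) {J : Type*}
    [Fintype J] {F : J → C} (hF : ∀ i, D.deg α (F i))
    {π : ∀ i, (Z α).obj X ⟶ dual (F i) ⊗ (X ⊗ F i)} (hπ : ∑ i, π i ≫ (Z α).rho X (F i) (hF i) = 𝟙 _)
    {J' : J → Type*} [∀ i, Fintype (J' i)] {K : ∀ i, J' i → C} (hK : ∀ i l, D.deg γ (K i l))
    {p : ∀ i l, F i ⊗ Y ⟶ K i l} {q : ∀ i l, K i l ⟶ F i ⊗ Y}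
    (hpq : ∀ i, ∑ l, p i l ≫ q i l = 𝟙 (F i ⊗ Y)) :
    mix Z h X Y hY = ∑ i, ∑ l,
      π i ▷ Y ≫ braidTerm X (p i l) (q i l) ≫ Y ◁ (Z γ).rho X (K i l) (hK i l) := by
  calc _ = (∑ i, π i ≫ (Z α).rho X (F i) (hF i)) ▷ Y ≫ mix Z h X Y hY := by
        rw [hπ, id_whiskerRight, Category.id_comp]
    _ = ∑ i, π i ▷ Y ≫ (Z α).rho X (F i) (hF i) ▷ Y ≫ mix Z h X Y hY := by
        simp only [sum_whiskerRight, Preadditive.sum_comp, comp_whiskerRight, Category.assoc]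
    _ = _ := Finset.sum_congr rfl fun i _ => by
        rw [rho_whiskerRight_mix, (Z γ).part_eq_sum X _ (hK i) (hpq i), absorbFst_sum,
          Preadditive.comp_sum]
        simp only [braidTerm_whiskerLeft, Centralizer.part]

variable {S : Splittings D} {hp : IsPure C}

theorem freeIntertwiner_map (W : C) (hW : D.deg β W) :
    (freeIntertwiner Z h X).map W hW = mix Z h X W hW :=
  part_Z2 Z h X W hW

theorem isIso_omegaV (V : InvObj D β) : IsIso (omegaV Z S hp h X V) := by
  refine (freeIntertwiner Z h X).isIso_toHom S hp V (e := expand Z h X V.obj V.mem) ?_ ?_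
  · rw [freeIntertwiner_map]
    exact mix_expand Z h X V.obj V.obj V.mem V.mem
  · rw [freeIntertwiner_map]
    exact expand_absorb Z h X hp V.obj V.mem

variable (hn : NonSingular D) (L : Crossing S hp)

theorem isIso_omega : IsIso (omega Z hn L h X) := by
  obtain ⟨V⟩ := hn.exists_inv β
  have := isIso_omegaV Z h X (S := S) (hp := hp) V
  have := L.isIso_ι V
  rw [← ι_omegaV Z hn L h X V]
  infer_instance

theorem tau_omega (Y : C) (hY : D.deg β Y) :
    tau hn L (free Z α X) Y hY ≫ Y ◁ (omega Z hn L h X).hom = mix Z h X Y hY := by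
  obtain ⟨V⟩ := hn.exists_inv β
  rw [← ι_omegaV Z hn L h X V, ← freeIntertwiner_map]
  exact (freeIntertwiner Z h X).tau_comp_toHom hn L V Y hY

theorem tau_free (Y : C) (hY : D.deg β Y) [IsIso (omega Z hn L h X)] :
    tau hn L (free Z α X) Y hY = mix Z h X Y hY ≫ Y ◁ (inv (omega Z hn L h X)).hom :=
  RelCenter.eq_comp_whiskerLeft_inv _ (tau_omega Z h X hn L Y hY)

end FreeObjects

section Density

variable {C : Type u} [Category.{v} C] [Preadditive C] {J : Type*}

/-- `Y` is a retract of a finite direct sum of objects of the family `F`. No direct sum is required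
to exist: the retraction is recorded by its components. -/
def IsRetractOfSum (F : J → C) (Y : C) : Prop :=
  ∃ (n : ℕ) (a : Fin n → J) (p : ∀ l, Y ⟶ F (a l)) (q : ∀ l, F (a l) ⟶ Y), ∑ l, p l ≫ q l = 𝟙 Y

theorem exists_isDirectSum_of_existsUnique [Fintype J] {F : J → C} {T : C} (ρ : ∀ i, F i ⟶ T)
    (h : ∀ (B : C) (d : ∀ i, F i ⟶ B), ∃! r : T ⟶ B, ∀ i, ρ i ≫ r = d i) :
    ∃ π : ∀ i, T ⟶ F i, IsDirectSum ρ π := by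
  classical
  choose π hπ _ using fun i => h (F i) fun j =>
    if hji : j = i then eqToHom (congrArg F hji) else 0
  have ρ_π (i : J) : ρ i ≫ π i = 𝟙 (F i) := by rw [hπ, dif_pos rfl, eqToHom_refl]
  have ρ_π_ne (i j : J) (hij : i ≠ j) : ρ i ≫ π j = 0 := by rw [hπ, dif_neg hij]
  refine ⟨π, ρ_π, ρ_π_ne, (h T ρ).unique (fun i => ?_) fun i => Category.comp_id _⟩
  rw [Preadditive.comp_sum, Finset.sum_eq_single_of_mem i (Finset.mem_univ i), reassoc_of% ρ_π]
  intro j _ hji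
  rw [reassoc_of% ρ_π_ne i j hji.symm, zero_comp]

theorem isDirectSum_of_iso_biproduct [Fintype J] {f F : J → C} [HasBiproduct f] {T : C}
    (e : T ≅ ⨁ f) (a : ∀ m, f m ≅ F m) :
    IsDirectSum (fun m => (a m).inv ≫ biproduct.ι f m ≫ e.inv)
      (fun m => e.hom ≫ biproduct.π f m ≫ (a m).hom) where
  ρ_π m := by simp
  ρ_π_ne l m hlm := by simp [biproduct.ι_π_ne_assoc f hlm]
  sum := by
    have total : ∑ m, biproduct.π f m ≫ biproduct.ι f m = 𝟙 (⨁ f) :=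
      IsBilimit.total (biproduct.isBilimit f)
    calc _ = e.hom ≫ (∑ m, biproduct.π f m ≫ biproduct.ι f m) ≫ e.inv := by
          simp only [Preadditive.sum_comp, Preadditive.comp_sum, Category.assoc,
            Iso.hom_inv_id_assoc]
      _ = 𝟙 T := by rw [total, Category.id_comp, e.hom_inv_id]

variable [MonoidalCategory C] [MonoidalPreadditive C] {F : J → C} {X Y B : C}

namespace IsRetractOfSum

theorem whiskerLeft_ext (hY : IsRetractOfSum F Y) {t t' : X ⊗ Y ⟶ B}
    (h : ∀ (j : J) (g : F j ⟶ Y), X ◁ g ≫ t = X ◁ g ≫ t') : t = t' := by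
  obtain ⟨n, a, p, q, hpq⟩ := hY
  have expand_id (s : X ⊗ Y ⟶ B) : s = ∑ l, X ◁ p l ≫ X ◁ q l ≫ s := by
    simp only [← MonoidalCategory.whiskerLeft_comp_assoc, ← Preadditive.sum_comp, ← whiskerLeft_sum,
      hpq, MonoidalCategory.whiskerLeft_id, Category.id_comp]
  rw [expand_id t, expand_id t']
  simp only [h]

theorem exists_extension (hY : IsRetractOfSum F Y) {θ : ∀ j, X ⊗ F j ⟶ F j ⊗ B}
    (hθ : ∀ (i j : J) (g : F i ⟶ F j), X ◁ g ≫ θ j = θ i ≫ g ▷ B) :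
    ∃ t : X ⊗ Y ⟶ Y ⊗ B, ∀ (j : J) (g : F j ⟶ Y), X ◁ g ≫ t = θ j ≫ g ▷ B := by
  obtain ⟨n, a, p, q, hpq⟩ := hY
  refine ⟨∑ l, X ◁ p l ≫ θ (a l) ≫ q l ▷ B, fun j g => ?_⟩
  calc _ = ∑ l, (X ◁ (g ≫ p l) ≫ θ (a l)) ≫ q l ▷ B := by
        simp only [Preadditive.comp_sum, MonoidalCategory.whiskerLeft_comp, Category.assoc]
    _ = θ j ≫ (g ≫ ∑ l, p l ≫ q l) ▷ B := by
        simp only [hθ, Preadditive.comp_sum, sum_whiskerRight, comp_whiskerRight, Category.assoc]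
    _ = _ := by rw [hpq, Category.comp_id]

end IsRetractOfSum

namespace Centralizer

variable [PivotalCategory C] {P : ObjectProperty C} (Z : Centralizer P) (hF : ∀ j, P (F j))
  (hP : ∀ Y, P Y → IsRetractOfSum F Y)

include hP in
theorem existsUnique_part_comp {θ : ∀ j, X ⊗ F j ⟶ F j ⊗ B}
    (hθ : ∀ (i j : J) (g : F i ⟶ F j), X ◁ g ≫ θ j = θ i ≫ g ▷ B) :
    ∃! r : Z.obj X ⟶ B, ∀ j, Z.part X (F j) (hF j) ≫ F j ◁ r = θ j := by
  choose t ht using fun Y hY => (hP Y hY).exists_extension hθ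
  obtain ⟨r, hr, unique⟩ := Z.existsUnique X B t fun Y Y' hY hY' f =>
    (hP Y hY).whiskerLeft_ext fun j g => by
      rw [← MonoidalCategory.whiskerLeft_comp_assoc, ht, comp_whiskerRight, reassoc_of% ht]
  refine ⟨r, fun j => ?_, fun r' hr' => unique r' fun Y hY =>
    (hP Y hY).whiskerLeft_ext fun j g => ?_⟩
  · simpa only [hr, MonoidalCategory.whiskerLeft_id, id_whiskerRight, Category.id_comp,
      Category.comp_id] using ht (F j) (hF j) j (𝟙 _)
  · rw [Z.part_comp_natural X (hF j) hY g r', hr', ht]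

end Centralizer

variable {k : Type*} [CommRing k] [Linear k C]

variable (k) in
/-- A family of objects satisfying the conclusion of Schur's lemma: there are no non-zero morphisms
between distinct members, and every endomorphism of a member is a scalar. -/
structure IsSchurFamily (F : J → C) : Prop where
  hom_eq_zero (i j : J) : i ≠ j → ∀ f : F i ⟶ F j, f = 0
  exists_smul_id (i : J) (f : F i ⟶ F i) : ∃ c : k, f = c • 𝟙 (F i)

namespace IsSchurFamily

variable [MonoidalLinear k C] (hS : IsSchurFamily k F)
include hS

theorem whiskerLeft_comp_eq (θ : ∀ j, X ⊗ F j ⟶ F j ⊗ B) (i j : J) (g : F i ⟶ F j) :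
    X ◁ g ≫ θ j = θ i ≫ g ▷ B := by
  obtain rfl | hij := eq_or_ne i j
  · obtain ⟨c, rfl⟩ := hS.exists_smul_id i g
    simp
  · simp [hS.hom_eq_zero i j hij g]

variable [PivotalCategory C] {P : ObjectProperty C} (Z : Centralizer P) (hF : ∀ j, P (F j))
  (hP : ∀ Y, P Y → IsRetractOfSum F Y)
include hP

theorem existsUnique_rho_comp (d : ∀ j, dual (F j) ⊗ (X ⊗ F j) ⟶ B) :
    ∃! r : Z.obj X ⟶ B, ∀ j, Z.rho X (F j) (hF j) ≫ r = d j := by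
  simp only [Z.rho_comp_eq_iff]
  exact Z.existsUnique_part_comp hF hP (hS.whiskerLeft_comp_eq _)

theorem exists_isDirectSum_rho [Fintype J] (X : C) :
    ∃ π : ∀ j, Z.obj X ⟶ dual (F j) ⊗ (X ⊗ F j),
      IsDirectSum (fun j => Z.rho X (F j) (hF j)) π :=
  exists_isDirectSum_of_existsUnique _ fun _ d => hS.existsUnique_rho_comp Z hF hP d

end IsSchurFamily

end Density

section Fusion

variable {k : Type*} [CommRing k] {C : Type u} [Category.{v} C] [Preadditive C] [Linear k C]

namespace IsSimpleObj

theorem exists_smul_id {j : C} (h : IsSimpleObj k j) (g : j ⟶ j) : ∃ c : k, g = c • 𝟙 j := by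
  obtain ⟨e⟩ := h
  have eq_smul (f : j ⟶ j) : f = e.symm f • e 1 := by
    rw [← map_smul, smul_eq_mul, mul_one, e.apply_symm_apply]
  obtain ⟨a, ha⟩ : ∃ a : k, 𝟙 j = a • e 1 := ⟨_, eq_smul _⟩
  obtain ⟨b, hb⟩ : ∃ b : k, e 1 ≫ e 1 = b • e 1 := ⟨_, eq_smul _⟩
  have generator_eq : e 1 = b • 𝟙 j := by
    calc e 1 = e 1 ≫ 𝟙 j := (Category.comp_id _).symm
      _ = b • 𝟙 j := by rw [ha, Linear.comp_smul, hb, smul_comm]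
  exact ⟨e.symm g * b, by rw [mul_smul, ← generator_eq]; exact eq_smul g⟩

theorem id_ne_zero [Nontrivial k] {j : C} (h : IsSimpleObj k j) : 𝟙 j ≠ 0 := by
  obtain ⟨e⟩ := h
  have := e.symm.toEquiv.nontrivial
  intro hj
  obtain ⟨f, hf⟩ := exists_ne (0 : j ⟶ j)
  exact hf (by rw [← Category.comp_id f, hj, comp_zero])

variable {G : Type w} [Group G] [MonoidalCategory C] [PivotalCategory C] [HasFiniteBiproducts C]
  {D : PivotalGrading G C}

theorem deg_of_retract [Nontrivial k] {j T : C} (h : IsSimpleObj k j) {γ δ : G} (hj : D.deg γ j)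
    (hT : D.deg δ T) {q : j ⟶ T} {p : T ⟶ j} (hqp : q ≫ p = 𝟙 j) : D.deg δ j := by
  obtain rfl | hne := eq_or_ne γ δ
  · exact hj
  · exact absurd (by rw [← hqp, D.hom_eq_zero hj hT hne q, zero_comp]) h.id_ne_zero

end IsSimpleObj

variable {G : Type w} [Group G] [MonoidalCategory C] [PivotalCategory C] [HasFiniteBiproducts C]
  {D : PivotalGrading G C} {I : Set C} {δ : G}

theorem Partition.isRetractOfSum {T : C} (N : Partition D I δ T) :
    IsRetractOfSum (fun i : Component D I δ => i.1) T :=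
  ⟨N.n, N.idx, N.p, N.q, N.isDirectSum.sum⟩

theorem IsGRepresentative.eq_of_iso (hI : IsGRepresentative k D I) {i j : Component D I δ}
    (e : i.1 ≅ j.1) : i = j :=
  Subtype.ext ((hI.existsUnique i.1 (hI.simple _ i.2.1)).unique ⟨i.2.1, ⟨Iso.refl _⟩⟩
    ⟨j.2.1, ⟨e⟩⟩)

namespace IsGFusion

variable (hF : IsGFusion k D) (hI : IsGRepresentative k D I)
include hF hI

theorem isSchurFamily_component : IsSchurFamily k (fun i : Component D I δ => i.1) where
  hom_eq_zero i j hij := hF.hom_eq_zero i.1 j.1 (hI.simple _ i.2.1) (hI.simple _ j.2.1)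
    fun ⟨e⟩ => hij (hI.eq_of_iso e)
  exists_smul_id i := (hI.simple _ i.2.1).exists_smul_id

theorem nonempty_partition {T : C} (hT : D.deg δ T) : Nonempty (Partition D I δ T) := by
  obtain hk | hk := subsingleton_or_nontrivial k
  · have := Module.subsingleton k (T ⟶ T)
    exact ⟨0, Fin.elim0, (·.elim0), (·.elim0), (·.elim0), (·.elim0), Subsingleton.elim _ _⟩
  obtain ⟨n, f, hf, ⟨e⟩⟩ := hF.exists_decomposition T
  choose j hj _ using fun m => hI.existsUnique (f m) (hf m)
  have sum := isDirectSum_of_iso_biproduct e fun m => (hj m).2.some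
  refine ⟨n, fun m => ⟨j m, (hj m).1, ?_⟩, _, _, sum⟩
  obtain ⟨γ, hγ⟩ := hI.homogeneous (j m) (hj m).1
  exact (hI.simple _ (hj m).1).deg_of_retract hγ hT (sum.ρ_π m)

end IsGFusion

end Fusion

end

end GCat

theorem theorem9p4 {k : Type*} [CommRing k] {G : Type w} [Group G] {C : Type u} [Category.{v} C]
    [MonoidalCategory C] [PivotalCategory C] [Preadditive C] [Linear k C] [MonoidalPreadditive C]
    [MonoidalLinear k C] [HasFiniteBiproducts C] (D : PivotalGrading G C) (hD : NonSingular D)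
    (S : Splittings D) (L : Crossing S hD.pure) (Z : ∀ α : G, Centralizer (D.deg α))
    (α β : G) (X Y : C) (hY : D.deg β Y) :
    ∃ _ : IsIso (omega Z hD L (rfl : α * β = α * β) X),
      tau hD L (free Z α X) Y hY =
        (Z β).part ((Z α).obj X) Y hY ≫
          Y ◁ (Z2 Z (rfl : α * β = α * β) X ≫ (inv (omega Z hD L rfl X)).hom) ∧
      ∀ (hF : IsGFusion k D) (I : Set C) (hI : IsGRepresentative k D I),
        letI := fun δ : G => componentFintype hF hI δ
        (∀ δ : G, ∃ π : ∀ i : Component D I δ, (Z δ).obj X ⟶ dual i.1 ⊗ (X ⊗ i.1),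
          IsDirectSum (fun i : Component D I δ => (Z δ).rho X i.1 i.2.2) π) ∧
        (∀ i : Component D I α, Nonempty (Partition D I (α * β) (i.1 ⊗ Y))) ∧
        ∀ (π : ∀ i : Component D I α, (Z α).obj X ⟶ dual i.1 ⊗ (X ⊗ i.1)),
          IsDirectSum (fun i : Component D I α => (Z α).rho X i.1 i.2.2) π →
          ∀ (P : ∀ i : Component D I α, Partition D I (α * β) (i.1 ⊗ Y)),
            tau hD L (free Z α X) Y hY =
              (∑ i : Component D I α, ∑ l : Fin (P i).n,
                π i ▷ Y ≫ braidTerm X ((P i).p l) ((P i).q l) ≫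
                  Y ◁ (Z (α * β)).rho X ((P i).idx l).1 ((P i).idx l).2.2) ≫
              Y ◁ (inv (omega Z hD L rfl X)).hom := by
  have hω := isIso_omega Z (rfl : α * β = α * β) X hD L
  have tau_eq := tau_free Z (rfl : α * β = α * β) X hD L Y hY
  refine ⟨hω, ?_, fun hF I hI => ?_⟩
  · exact tau_eq.trans (part_comp_whiskerLeft_Z2_comp Z rfl X Y hY _).symm
  · let := fun δ : G => componentFintype hF hI δ
    refine ⟨fun δ => ?_, fun i => hF.nonempty_partition hI (D.tensor_mem i.2.2 hY),
      fun π hπ P => ?_⟩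
    · exact (hF.isSchurFamily_component hI).exists_isDirectSum_rho (Z δ) (fun i => i.2.2)
        (fun T hT => (hF.nonempty_partition hI hT).some.isRetractOfSum) X
    · rw [tau_eq, mix_eq_sum_braidTerm Z rfl X Y hY (fun i => i.2.2) hπ.sum
        (fun i l => ((P i).idx l).2.2) fun i => (P i).isDirectSum.sum]
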